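/- **Theorem (simultaneous coverage of structured conformalized matrix completion).** Let $M\in\mathbb R^{n_r\times n_c}$ be a fixed matrix, $K\ge 1$, $n\ge 0$, $\alpha\in(0,1)$, and let $w,w^*$ be nonnegative weights on $[n_r]\times[n_c]$. For a finite set $S$ of indices and weights $v$, $\Psi(m,S,v)$ denotes the law of $m$ successive draws from $S$ without replacement, each with probability proportional to $v$ among the elements left; $\Psi^{\mathrm{col}}(m,S,v)$ is the same, except that from the second draw on only elements of the column of the first draw are allowed. For a set $D$ of indices, $D^c$ in column notation means $D\cap([n_r]\times\{c\})$. *Sampling model.* $X_{\mathrm{obs}}\sim\Psi(n_{\mathrm{obs}},[n_r]\times[n_c],w)$; $\mathcal D_{\mathrm{obs}}$ is its set of entries and $\mathcal D_{\mathrm{miss}}$ the complement. Given $\mathcal D_{\mathrm{obs}}$, the test group is $X^*=(X^*_1,\dots,X^*_K)\sim\Psi^{\mathrm{col}}(K,\bar{\mathcal D}_{\mathrm{miss}},w^*)$, independently of the randomness of the calibration algorithm below, where $\bar{\mathcal D}_{\mathrm{miss}}$ consists of the missing entries in columns with at least $K$ missing entries (so $\bar{\mathcal D}_{\mathrm{miss}}=\mathcal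 D_{\mathrm{miss}}$ if all columns have at least $K$ missing entries). *Calibration groups.* Let $n^c_{\mathrm{obs}}=|\mathcal D^c_{\mathrm{obs}}|$. Given $\mathcal D_{\mathrm{obs}}$, for each column $c$ independently, put a uniformly random set of $n^c_{\mathrm{obs}}\bmod K$ entries of $\mathcal D^c_{\mathrm{obs}}$ into $\mathcal D_{\mathrm{prune}}$. Starting with $\mathcal D_{\mathrm{avail}}=\mathcal D_{\mathrm{obs}}\setminus\mathcal D_{\mathrm{prune}}$, for $i=1,\dots,n$ draw $X^{\mathrm{cal}}_i\sim\Psi^{\mathrm{col}}(K,\mathcal D_{\mathrm{avail}},1)$ and remove its entries from $\mathcal D_{\mathrm{avail}}$. Finally $\mathcal D_{\mathrm{train}}=\mathcal D_{\mathrm{prune}}\cup\mathcal D_{\mathrm{avail}}$. It is assumed that all these steps are well defined (in particular $n\le\sum_c\lfloor n^c_{\mathrm{obs}}/K\rfloor$ almost surely). *Prediction rule and scores.* Let $\widehat M$ be computed from the entries of $M$ in $\mathcal D_{\mathrm{train}}$ by an arbitrary algorithm, and for $\tau\in[0,1]$ and a $K$-tuple $x$ of indices let $\mathcal C(x,\tau,\widehat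 M)\subseteq\mathbb R^K$ be nondecreasing in $\tau$, with $\mathcal C(x,0,\widehat M)=\{(\widehat M_{x_1},\dots,\widehat M_{x_K})\}$ and $\lim_{\tau\to1^-}\mathcal C(x,\tau,\widehat M)=\mathbb R^K$, almost surely. The score of $x$ is $S(x)=\inf\{\tau\in[0,1]: M_x\in\mathcal C(x,\tau,\widehat M)\}$, where $M_x=(M_{x_1},\dots,M_{x_K})$. Assume that almost surely these infima are attained for all $x$, or else that almost surely the scores $S_i=S(X^{\mathrm{cal}}_i)$, $i\le n$, and $S(X^*)$ are pairwise distinct. *Weights.* Write $x_1,\dots,x_n,x_{n+1}$ for $X^{\mathrm{cal}}_1,\dots,X^{\mathrm{cal}}_n,X^*$, let $c_i$ be the column of $x_i$, $\bar n^c_{\mathrm{obs}}=n^c_{\mathrm{obs}}-(n^c_{\mathrm{obs}}\bmod K)$, $D_{\mathrm{obs};n+1}=\mathcal D_{\mathrm{obs}}$, and for $i\le n$ let $D_{\mathrm{obs};i}$ be $\mathcal D_{\mathrm{obs}}$ with the entries of $x_{n+1}$ added and those of $x_i$ removed. Let $\mathbb P_w(D)$ be the probability that the set of entries of a sample from $\Psi(n_{\mathrm{obs}},[n_r]\times[n_c],w)$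 is $D$. Define $p_1,\dots,p_{n+1}$, with $\sum_i p_i=1$, by $$p_i\propto \mathbb P_w(D_{\mathrm{obs};i})\prod_{k=1}^K\widetilde w^*_{x_{i,k}}\left[\frac{\binom{n^{c_i}_{\mathrm{obs}}}{\bar n^{c_i}_{\mathrm{obs}}}}{\binom{n^{c_i}_{\mathrm{obs}}-K}{\bar n^{c_i}_{\mathrm{obs}}-K}}\cdot\frac{\binom{n^{c_{n+1}}_{\mathrm{obs}}}{\bar n^{c_{n+1}}_{\mathrm{obs}}}}{\binom{n^{c_{n+1}}_{\mathrm{obs}}+K}{\bar n^{c_{n+1}}_{\mathrm{obs}}+K}}\prod_{k=1}^{K-1}\frac{\bar n^{c_i}_{\mathrm{obs}}-k}{\bar n^{c_{n+1}}_{\mathrm{obs}}+K-k}\right]^{\mathbb 1\{c_i\ne c_{n+1}\}},$$ $$\widetilde w^*_{x_{i,1}}=\frac{w^*_{x_{i,1}}}{\sum_{e\in\mathcal D_{\mathrm{miss}}}w^*_e-\sum_{k=1}^K(w^*_{x_{n+1,k}}-w^*_{x_{i,k}})},\qquad \widetilde w^*_{x_{i,k}}=\frac{w^*_{x_{i,k}}}{\sum_{e\in\mathcal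 D_{\mathrm{miss}}^{c_i}}w^*_e+\sum_{k'=k}^Kw^*_{x_{i,k'}}-\mathbb 1\{c_i=c_{n+1}\}\sum_{k'=1}^Kw^*_{x_{n+1,k'}}}\quad(k\ge2).$$ Let $p'_1,\dots,p'_{n+1}$ be defined in the same way, except that the denominator of $\widetilde w^*_{x_{i,1}}$ is replaced by the total $w^*$-weight of those entries outside $D_{\mathrm{obs};i}$ that lie in columns with at least $K$ entries outside $D_{\mathrm{obs};i}$. *Region.* Let $\widehat\tau=\inf\{s\in\mathbb R:\sum_{i\le n,\,S_i\le s}p_i\ge1-\alpha\}$, the $(1-\alpha)$-quantile of $\sum_{i=1}^np_i\delta_{S_i}+p_{n+1}\delta_\infty$, and $\widehat C=\mathcal C(X^*,\widehat\tau,\widehat M)$, with $\widehat C=\mathbb R^K$ if $\widehat\tau=\infty$. Let $\widehat C'$ be the region obtained in the same way from the weights $p'_i$. *Conclusion.* Let $(D_1,D_0)$ be any value taken by $(\mathcal D_{\mathrm{train}},\mathcal D_{\mathrm{prune}})$ with positive probability. 1. If, conditionally on $\mathcal D_{\mathrm{train}}=D_1,\mathcal D_{\mathrm{prune}}=D_0$,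 almost surely every column has at least $K$ missing entries, then $\mathbb P\big(M_{X^*}\in\widehat C\mid\mathcal D_{\mathrm{train}}=D_1,\mathcal D_{\mathrm{prune}}=D_0\big)\ge1-\alpha$. 2. Without this assumption, $\mathbb P\big(M_{X^*}\in\widehat C'\mid\mathcal D_{\mathrm{train}}=D_1,\mathcal D_{\mathrm{prune}}=D_0\big)\ge1-\alpha$. -/

import Mathlib

open MeasureTheory

noncomputable section

namespace SCMC

/-- Indices `(row, column)` of the entries of an `nr × nc` matrix. -/
abbrev Idx (nr nc : ℕ) : Type := Fin nr × Fin nc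

variable {nr nc : ℕ}

/-! ### Weighted sampling without replacement -/

/-- One weighted draw `Ψ(1, S, w)`: the probability that it returns `e`. -/
def draw (S : Finset (Idx nr nc)) (w : Idx nr nc → ℝ) (e : Idx nr nc) : ℝ :=
  if e ∈ S then w e / ∑ y ∈ S, w y else 0

/-- The entries of a tuple that come strictly before position `i`. -/
def before {m : ℕ} (x : Fin m → Idx nr nc) (i : Fin m) : Finset (Idx nr nc) :=
  (Finset.univ.filter (fun j : Fin m => j < i)).image x

/-- The set of entries of a tuple. -/
def entries {m : ℕ} (x : Fin m → Idx nr nc) : Finset (Idx nr nc) := Finset.univ.image x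

/-- `Ψ(m, S, w)`: the probability of the ordered sample `x` when `m` elements are drawn from `S`
one after the other, without replacement, with probabilities proportional to `w`. -/
def psi {m : ℕ} (S : Finset (Idx nr nc)) (w : Idx nr nc → ℝ) (x : Fin m → Idx nr nc) : ℝ :=
  ∏ i, draw (S \ before x i) w (x i)

/-- The probability that the unordered sample of `Ψ(m, S, w)` is `A`. -/
def psiSet (m : ℕ) (S : Finset (Idx nr nc)) (w : Idx nr nc → ℝ) (A : Finset (Idx nr nc)) : ℝ :=
  ∑ x ∈ Finset.univ.filter (fun x : Fin m → Idx nr nc => entries x = A), psi S w x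

/-- `Ψ^col(K, S, w)`: as `Ψ(K, S, w)`, but from the second draw on the weights are set to zero
outside the column that contains the elements drawn before. -/
def psiCol {K : ℕ} (S : Finset (Idx nr nc)) (w : Idx nr nc → ℝ) (x : Fin K → Idx nr nc) : ℝ :=
  ∏ k, draw (S \ before x k) (fun e => if ∀ j, j < k → e.2 = (x j).2 then w e else 0) (x k)

/-- The elements of `D` in column `c`. -/
def col (D : Finset (Idx nr nc)) (c : Fin nc) : Finset (Idx nr nc) := D.filter (fun e => e.2 = c)

/-- The missing entries, given the set `D` of observed entries, that lie in a column with at least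
`K` missing entries. -/
def prunedMiss (K : ℕ) (D : Finset (Idx nr nc)) : Finset (Idx nr nc) :=
  Dᶜ.filter (fun e => K ≤ (col Dᶜ e.2).card)

/-! ### Assembling the calibration groups -/

/-- The probability that the pruned set is `A`, given the observed set `D`: independently in each
column `c`, a uniform sample without replacement of size `n^c mod K` is taken, where `n^c` is the
number of observed entries in that column. -/
def pruneMass (K : ℕ) (D A : Finset (Idx nr nc)) : ℝ :=
  ∏ c, psiSet ((col D c).card % K) (col D c) (fun _ => 1) (col A c)

/-- All matrix entries that occur in some of the given groups. -/
def groupEntries {n K : ℕ} (x : Fin n → Fin K → Idx nr nc) : Finset (Idx nr nc) :=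
  Finset.univ.biUnion (fun i => entries (x i))

/-- The probability that the calibration groups are `x 0, …, x (n-1)`: each is drawn from
`Ψ^col(K, ·, 1)` on the entries of `S` that are still available. -/
def calMass {n K : ℕ} (S : Finset (Idx nr nc)) (x : Fin n → Fin K → Idx nr nc) : ℝ :=
  ∏ i, psiCol (S \ (Finset.univ.filter (fun j : Fin n => j < i)).biUnion (fun j => entries (x j)))
    (fun _ => 1) (x i)

/-- The training set: the pruned set `A` with the entries of `D \ A` used by no group. -/
def trainSet {n K : ℕ} (D A : Finset (Idx nr nc)) (x : Fin n → Fin K → Idx nr nc) :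
    Finset (Idx nr nc) :=
  A ∪ ((D \ A) \ groupEntries x)

/-- The joint law of the observed indices `Xobs`, the pruned set `Dprune`, the calibration groups
`Xcal` and the test group `Xstar`, given step by step: `Xobs ∼ Ψ(nobs, [nr] × [nc], w)`; `Dprune`
and `Xcal` are drawn from the observed set by the calibration algorithm; and, conditionally on the
observed set and independently of the randomness of the algorithm, `Xstar` is drawn from `Ψ^col`
with weights `wstar` on the missing entries in columns with at least `K` missing entries. -/
structure IsSample {Ω : Type*} [MeasurableSpace Ω] (μ : Measure Ω) {nobs n K : ℕ}
    (w wstar : Idx nr nc → ℝ) (Xobs : Ω → Fin nobs → Idx nr nc)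
    (Dprune : Ω → Finset (Idx nr nc)) (Xcal : Ω → Fin n → Fin K → Idx nr nc)
    (Xstar : Ω → Fin K → Idx nr nc) : Prop where
  measurable_obs : ∀ x, MeasurableSet {ω | Xobs ω = x}
  measurable_prune : ∀ A, MeasurableSet {ω | Dprune ω = A}
  measurable_cal : ∀ x, MeasurableSet {ω | Xcal ω = x}
  measurable_star : ∀ x, MeasurableSet {ω | Xstar ω = x}
  law_obs : ∀ x, μ.real {ω | Xobs ω = x} = psi Finset.univ w x
  law_prune : ∀ D A,
    μ.real {ω | entries (Xobs ω) = D ∧ Dprune ω = A} =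
      μ.real {ω | entries (Xobs ω) = D} * pruneMass K D A
  law_cal : ∀ D A x,
    μ.real {ω | entries (Xobs ω) = D ∧ Dprune ω = A ∧ Xcal ω = x} =
      μ.real {ω | entries (Xobs ω) = D ∧ Dprune ω = A} * calMass (D \ A) x
  law_star : ∀ D A x y,
    μ.real {ω | entries (Xobs ω) = D ∧ Dprune ω = A ∧ Xcal ω = x ∧ Xstar ω = y} =
      μ.real {ω | entries (Xobs ω) = D ∧ Dprune ω = A ∧ Xcal ω = x} *
        psiCol (prunedMiss K D) wstar y

/-! ### Conformalization weights

Here `D` is the observed set and `x : Fin (n + 1) → Fin K → Idx nr nc` lists the calibration groups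
followed by the test group `x (Fin.last n)`. -/

section Weights

variable {n K : ℕ} [NeZero K]

/-- The column of a group. -/
def groupCol (g : Fin K → Idx nr nc) : Fin nc := (g 0).2

/-- The observed set after swapping the test group with the group `i`. -/
def swapObs (D : Finset (Idx nr nc)) (x : Fin (n + 1) → Fin K → Idx nr nc) (i : Fin (n + 1)) :
    Finset (Idx nr nc) :=
  if i = Fin.last n then D else (D ∪ entries (x (Fin.last n))) \ entries (x i)

/-- Denominator of the first test weight, when all columns have enough missing entries. -/
def firstDenom (wstar : Idx nr nc → ℝ) (D : Finset (Idx nr nc))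
    (x : Fin (n + 1) → Fin K → Idx nr nc) (i : Fin (n + 1)) : ℝ :=
  ∑ e ∈ Dᶜ, wstar e - ∑ k, (wstar (x (Fin.last n) k) - wstar (x i k))

/-- Denominator of the first test weight in general: the total weight of the missing entries, after
the swap, that lie in columns with at least `K` missing entries. -/
def firstDenomPruned (wstar : Idx nr nc → ℝ) (D : Finset (Idx nr nc))
    (x : Fin (n + 1) → Fin K → Idx nr nc) (i : Fin (n + 1)) : ℝ :=
  ∑ e ∈ prunedMiss K (swapObs D x i), wstar e

/-- Denominator of the `k`-th test weight, for every `k` but the first. -/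
def laterDenom (wstar : Idx nr nc → ℝ) (D : Finset (Idx nr nc))
    (x : Fin (n + 1) → Fin K → Idx nr nc) (i : Fin (n + 1)) (k : Fin K) : ℝ :=
  ∑ e ∈ col Dᶜ (groupCol (x i)), wstar e
    + ∑ k' ∈ Finset.univ.filter (fun k' : Fin K => k ≤ k'), wstar (x i k')
    - if groupCol (x i) = groupCol (x (Fin.last n)) then ∑ k', wstar (x (Fin.last n) k') else 0

/-- The normalized test weights of the entries of group `i`, with first denominator `d`. -/
def testWeight (wstar : Idx nr nc → ℝ) (D : Finset (Idx nr nc))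
    (x : Fin (n + 1) → Fin K → Idx nr nc) (d : ℝ) (i : Fin (n + 1)) (k : Fin K) : ℝ :=
  if k = 0 then wstar (x i k) / d else wstar (x i k) / laterDenom wstar D x i k

/-- The number `n^c` of observed entries in column `c`. -/
def nObs (D : Finset (Idx nr nc)) (c : Fin nc) : ℕ := (col D c).card

/-- The number of observed entries left in column `c` after pruning. -/
def nBar (K : ℕ) (D : Finset (Idx nr nc)) (c : Fin nc) : ℕ := nObs D c - nObs D c % K

/-- The correction factor for a calibration group in column `c` and a test group in column `c'`,
where `c ≠ c'`. -/
def colFactor (K : ℕ) (D : Finset (Idx nr nc)) (c c' : Fin nc) : ℝ :=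
  ((nObs D c).choose (nBar K D c) : ℝ) / ((nObs D c - K).choose (nBar K D c - K) : ℝ)
    * (((nObs D c').choose (nBar K D c') : ℝ) / ((nObs D c' + K).choose (nBar K D c' + K) : ℝ))
    * ∏ k ∈ Finset.Icc 1 (K - 1), ((nBar K D c : ℝ) - k) / ((nBar K D c' : ℝ) + K - k)

/-- The conformalization weight of group `i` before normalization, with first denominators `d`. -/
def rawWeight (nobs : ℕ) (w wstar : Idx nr nc → ℝ) (D : Finset (Idx nr nc))
    (x : Fin (n + 1) → Fin K → Idx nr nc) (d : Fin (n + 1) → ℝ) (i : Fin (n + 1)) : ℝ :=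
  psiSet nobs Finset.univ w (swapObs D x i)
    * (∏ k, testWeight wstar D x (d i) i k)
    * if groupCol (x i) = groupCol (x (Fin.last n)) then 1
      else colFactor K D (groupCol (x i)) (groupCol (x (Fin.last n)))

/-- The conformalization weights when all columns have enough missing entries. -/
def confWeight (nobs : ℕ) (w wstar : Idx nr nc → ℝ) (D : Finset (Idx nr nc))
    (x : Fin (n + 1) → Fin K → Idx nr nc) (i : Fin (n + 1)) : ℝ :=
  rawWeight nobs w wstar D x (firstDenom wstar D x) i
    / ∑ j, rawWeight nobs w wstar D x (firstDenom wstar D x) j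

/-- The conformalization weights in general. -/
def confWeightPruned (nobs : ℕ) (w wstar : Idx nr nc → ℝ) (D : Finset (Idx nr nc))
    (x : Fin (n + 1) → Fin K → Idx nr nc) (i : Fin (n + 1)) : ℝ :=
  rawWeight nobs w wstar D x (firstDenomPruned wstar D x) i
    / ∑ j, rawWeight nobs w wstar D x (firstDenomPruned wstar D x) j

end Weights

/-! ### Prediction rules, scores and the confidence region -/

/-- The entries of `M` indexed by the tuple `x`. -/
def valuesAt {K : ℕ} (M : Matrix (Fin nr) (Fin nc) ℝ) (x : Fin K → Idx nr nc) : Fin K → ℝ :=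
  fun k => M (x k).1 (x k).2

/-- A prediction rule: `C x τ Mhat` is the candidate region for the entries indexed by `x`;
only `τ ∈ [0, 1]` is meaningful. -/
abbrev Rule (nr nc K : ℕ) : Type :=
  (Fin K → Idx nr nc) → ℝ → Matrix (Fin nr) (Fin nc) ℝ → Set (Fin K → ℝ)

/-- Monotonicity and boundary conditions of a prediction rule at the point estimate `Mhat`. -/
structure IsRuleAt {K : ℕ} (C : Rule nr nc K) (Mhat : Matrix (Fin nr) (Fin nc) ℝ) : Prop where
  mono : ∀ x, ∀ τ₁ ∈ Set.Icc (0 : ℝ) 1, ∀ τ₂ ∈ Set.Icc (0 : ℝ) 1, τ₁ < τ₂ →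
    C x τ₁ Mhat ⊆ C x τ₂ Mhat
  zero : ∀ x, C x 0 Mhat = {valuesAt Mhat x}
  one : ∀ x v, ∀ᶠ τ in nhdsWithin 1 (Set.Iio 1), v ∈ C x τ Mhat

/-- The values of `τ` for which the candidate region for the group `x` covers its entries of `M`. -/
def coveringParams {K : ℕ} (C : Rule nr nc K) (M Mhat : Matrix (Fin nr) (Fin nc) ℝ)
    (x : Fin K → Idx nr nc) : Set ℝ :=
  {τ | τ ∈ Set.Icc (0 : ℝ) 1 ∧ valuesAt M x ∈ C x τ Mhat}

/-- The conformity score of the group `x`. -/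
def score {K : ℕ} (C : Rule nr nc K) (M Mhat : Matrix (Fin nr) (Fin nc) ℝ)
    (x : Fin K → Idx nr nc) : ℝ :=
  sInf (coveringParams C M Mhat x)

/-- The `β` quantile of the distribution `∑ i, p i δ_{S i} + p_∞ δ_∞` on `ℝ ∪ {∞}`, where `p_∞` is
the remaining mass; it is `⊤` if no real number qualifies. -/
def wQuantile {n : ℕ} (β : ℝ) (p S : Fin n → ℝ) : EReal :=
  sInf ((fun s : ℝ => (s : EReal)) ''
    {s : ℝ | β ≤ ∑ i ∈ Finset.univ.filter (fun i => S i ≤ s), p i})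

/-- The joint confidence region for the test group `y`, from the calibration groups `x`, the
conformalization weights `p` (indexed by the calibration groups followed by the test group) and the
point estimate `Mhat`. An infinite calibrated value of `τ` gives the whole space. -/
def region {n K : ℕ} (C : Rule nr nc K) (M Mhat : Matrix (Fin nr) (Fin nc) ℝ) (α : ℝ)
    (p : Fin (n + 1) → ℝ) (x : Fin n → Fin K → Idx nr nc) (y : Fin K → Idx nr nc) :
    Set (Fin K → ℝ) :=
  let τ : EReal := wQuantile (1 - α) (fun i => p i.castSucc) (fun i => score C M Mhat (x i))
  if τ = ⊤ then Set.univ else C y τ.toReal Mhat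

end SCMC

end

noncomputable section

namespace SCMC

variable {nr nc : ℕ}

/-! ### Sampling without replacement -/

/-! The argument is weighted exchangeability of the `n + 1` groups. Fix values `D₁`, `D₀` of the
training and pruned sets, and let `F g j` be the mass of the groups `g` when `g j` is the test group
and the others are calibration groups (`exchangeMass`). Given the observed set, the law of the
pruning and of the calibration groups depends on the groups only through their number in each column
(`calMass_eq`, `pruneMass_mul_calMass`). Hence permuting `g` merely moves the test label
(`exchangeMass_comp_perm`). Moving the test label from the last group to group `i` changes the
probability of the observed set, the probability of the test draw, and the contributions of two
columns: that of `g i` loses a calibration group and that of the last group gains one. The factor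
`colFactor` is exactly the ratio of these contributions (`prod_columnMass_exchange`), so the general
weights are `F g i / ∑ j, F g j` (`confWeightPruned_eq`). On the conditioning event the estimate is
fixed, so the score is a fixed function of a group. If the region misses, the groups scoring
strictly below the test group have weight at least `1 - α` (`le_sum_of_notMem_region`). For any
nonnegative weights, the points with such a lower tail carry at most a share `α`
(`sum_filter_lowerTail_le`). Putting each group in turn in the test position turns this into a
probability bound (`sum_filter_lowerTail_last_le`), and `le_measureReal_inter` concludes. The first
claim reduces to the second: the two kinds of weights agree almost surely on the conditioning event
(`confWeight_eq_pruned`), once enough missing entries are known to remain after each relevant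
exchange (`le_card_col_obsAt`). -/

lemma mem_entries {m : ℕ} {x : Fin m → Idx nr nc} {e : Idx nr nc} :
    e ∈ entries x ↔ ∃ i, x i = e := by
  simp [entries]

lemma apply_mem_entries {m : ℕ} (x : Fin m → Idx nr nc) (i : Fin m) : x i ∈ entries x :=
  mem_entries.2 ⟨i, rfl⟩

lemma mem_before {m : ℕ} {x : Fin m → Idx nr nc} {i : Fin m} {e : Idx nr nc} :
    e ∈ before x i ↔ ∃ j, j < i ∧ x j = e := by
  simp [before]

lemma before_subset_entries {m : ℕ} (x : Fin m → Idx nr nc) (i : Fin m) :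
    before x i ⊆ entries x := by
  intro e he
  obtain ⟨j, -, rfl⟩ := mem_before.1 he
  exact apply_mem_entries x j

lemma mem_col {D : Finset (Idx nr nc)} {c : Fin nc} {e : Idx nr nc} :
    e ∈ col D c ↔ e ∈ D ∧ e.2 = c := by
  simp [col]

lemma apply_notMem_before {m : ℕ} {x : Fin m → Idx nr nc} (hx : Function.Injective x)
    (i : Fin m) : x i ∉ before x i := by
  intro h
  obtain ⟨j, hj, hji⟩ := mem_before.1 h
  exact hj.ne (hx hji)

lemma injective_of_notMem_before {m : ℕ} {x : Fin m → Idx nr nc}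
    (h : ∀ i, x i ∉ before x i) : Function.Injective x := by
  intro i j hij
  rcases lt_trichotomy i j with hlt | heq | hgt
  · exact absurd (mem_before.2 ⟨i, hlt, hij⟩) (h j)
  · exact heq
  · exact absurd (mem_before.2 ⟨j, hgt, hij.symm⟩) (h i)

lemma card_entries {m : ℕ} {x : Fin m → Idx nr nc} (hx : Function.Injective x) :
    (entries x).card = m := by
  simp [entries, Finset.card_image_of_injective _ hx]

lemma card_before {m : ℕ} {x : Fin m → Idx nr nc} (hx : Function.Injective x) (i : Fin m) :
    (before x i).card = i := by
  rw [before, Finset.card_image_of_injective _ hx, Finset.filter_gt_eq_Iio, Fin.card_Iio]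

lemma sum_before {m : ℕ} {x : Fin m → Idx nr nc} (hx : Function.Injective x)
    (w : Idx nr nc → ℝ) (i : Fin m) :
    ∑ e ∈ before x i, w e = ∑ j ∈ Finset.univ.filter (fun j : Fin m => j < i), w (x j) := by
  rw [before, Finset.sum_image (fun a _ b _ h => hx h)]

lemma sum_entries {m : ℕ} {x : Fin m → Idx nr nc} (hx : Function.Injective x)
    (w : Idx nr nc → ℝ) : ∑ e ∈ entries x, w e = ∑ j, w (x j) := by
  rw [entries, Finset.sum_image (fun a _ b _ h => hx h)]

lemma draw_ne_zero {S : Finset (Idx nr nc)} {w : Idx nr nc → ℝ} {e : Idx nr nc}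
    (h : draw S w e ≠ 0) : e ∈ S ∧ w e ≠ 0 := by
  unfold draw at h
  split_ifs at h with he
  · refine ⟨he, ?_⟩
    rintro h0
    simp [h0] at h
  · exact absurd rfl h

lemma psi_ne_zero {m : ℕ} {S : Finset (Idx nr nc)} {w : Idx nr nc → ℝ} {x : Fin m → Idx nr nc}
    (h : psi S w x ≠ 0) : Function.Injective x ∧ entries x ⊆ S := by
  have h' : ∀ i, x i ∈ S \ before x i := fun i =>
    (draw_ne_zero (Finset.prod_ne_zero_iff.1 h i (Finset.mem_univ i))).1
  refine ⟨injective_of_notMem_before fun i => (Finset.mem_sdiff.1 (h' i)).2, ?_⟩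
  intro e he
  obtain ⟨i, rfl⟩ := mem_entries.1 he
  exact (Finset.mem_sdiff.1 (h' i)).1

lemma psi_one {m : ℕ} {S : Finset (Idx nr nc)} {x : Fin m → Idx nr nc}
    (hx : Function.Injective x) (hS : entries x ⊆ S) :
    psi S (fun _ => 1) x = ((S.card.descFactorial m : ℕ) : ℝ)⁻¹ := by
  rw [Nat.descFactorial_eq_prod_range, ← Fin.prod_univ_eq_prod_range, Nat.cast_prod,
    ← Finset.prod_inv_distrib]
  refine Finset.prod_congr rfl fun i _ => ?_
  have hmem : x i ∈ S \ before x i :=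
    Finset.mem_sdiff.2 ⟨hS (apply_mem_entries x i), apply_notMem_before hx i⟩
  rw [draw, if_pos hmem, Finset.sum_const, nsmul_eq_mul, mul_one,
    Finset.card_sdiff_of_subset ((before_subset_entries x i).trans hS), card_before hx, one_div]

/-- The orderings of `A` are the bijections from `Fin m` to `A`. -/
lemma card_filter_entries_eq {m : ℕ} {A : Finset (Idx nr nc)} (hA : A.card = m) :
    (Finset.univ.filter (fun x : Fin m → Idx nr nc => entries x = A)).card = m.factorial := by
  classical
  have hcard : Fintype.card (Fin m ≃ A) = m.factorial := by
    rw [Fintype.card_equiv ((Fintype.equivFinOfCardEq (by simpa using hA)).symm), Fintype.card_fin]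
  rw [← hcard, ← Finset.card_univ]
  symm
  refine Finset.card_bij (fun σ _ i => ((σ i : A) : Idx nr nc)) ?_ ?_ ?_
  · intro σ _
    simp only [Finset.mem_filter, Finset.mem_univ, true_and]
    ext e
    rw [mem_entries]
    constructor
    · rintro ⟨i, rfl⟩
      exact (σ i).2
    · intro he
      exact ⟨σ.symm ⟨e, he⟩, by simp⟩
  · intro σ _ τ _ h
    exact Equiv.ext fun i => Subtype.ext (congrFun h i)
  · intro x hx
    simp only [Finset.mem_filter, Finset.mem_univ, true_and] at hx
    have hinj : Function.Injective x := by
      have : (Finset.univ.image x).card = (Finset.univ : Finset (Fin m)).card := by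
        have h1 : Finset.univ.image x = A := hx
        rw [h1, hA, Finset.card_univ, Fintype.card_fin]
      exact fun a b hab => Finset.card_image_iff.1 this (by simp) (by simp) hab
    have hmem : ∀ i, x i ∈ A := fun i => hx ▸ apply_mem_entries x i
    refine ⟨Equiv.ofBijective (fun i => ⟨x i, hmem i⟩) ⟨?_, ?_⟩, Finset.mem_univ _, rfl⟩
    · intro a b hab
      exact hinj (congrArg Subtype.val hab)
    · rintro ⟨e, he⟩
      obtain ⟨i, hi⟩ := mem_entries.1 (hx.symm ▸ he)
      exact ⟨i, Subtype.ext hi⟩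

lemma psiSet_ne_zero {m : ℕ} {S A : Finset (Idx nr nc)} {w : Idx nr nc → ℝ}
    (h : psiSet m S w A ≠ 0) : A ⊆ S ∧ A.card = m := by
  obtain ⟨x, hx, hne⟩ := Finset.exists_ne_zero_of_sum_ne_zero h
  obtain ⟨hinj, hS⟩ := psi_ne_zero hne
  simp only [Finset.mem_filter, Finset.mem_univ, true_and] at hx
  subst hx
  exact ⟨hS, card_entries hinj⟩

/-- All `m!` orderings of `A` are equally likely, and the falling factorial is `m!` times the
binomial coefficient. -/
lemma psiSet_one {m : ℕ} {S A : Finset (Idx nr nc)} (hS : A ⊆ S) (hA : A.card = m) :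
    psiSet m S (fun _ => 1) A = ((S.card.choose m : ℕ) : ℝ)⁻¹ := by
  have hpsi : ∀ x ∈ Finset.univ.filter (fun x : Fin m → Idx nr nc => entries x = A),
      psi S (fun _ => 1) x = ((S.card.descFactorial m : ℕ) : ℝ)⁻¹ := by
    intro x hx
    simp only [Finset.mem_filter, Finset.mem_univ, true_and] at hx
    refine psi_one ?_ (hx ▸ hS)
    have : (Finset.univ.image x).card = (Finset.univ : Finset (Fin m)).card := by
      have h1 : Finset.univ.image x = A := hx
      rw [h1, hA, Finset.card_univ, Fintype.card_fin]
    exact fun a b hab => Finset.card_image_iff.1 this (by simp) (by simp) hab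
  rw [psiSet, Finset.sum_congr rfl hpsi, Finset.sum_const, card_filter_entries_eq hA, nsmul_eq_mul,
    Nat.descFactorial_eq_factorial_mul_choose, Nat.cast_mul, mul_inv, ← mul_assoc,
    mul_inv_cancel₀ (by exact_mod_cast m.factorial_ne_zero), one_mul]

lemma pruneMass_ne_zero {K : ℕ} {D A : Finset (Idx nr nc)} (h : pruneMass K D A ≠ 0) :
    A ⊆ D ∧ ∀ c, (col A c).card = (col D c).card % K := by
  have h' := fun c => psiSet_ne_zero (Finset.prod_ne_zero_iff.1 h c (Finset.mem_univ c))
  refine ⟨fun e he => ?_, fun c => (h' c).2⟩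
  exact (mem_col.1 ((h' e.2).1 (mem_col.2 ⟨he, rfl⟩))).1

lemma col_mono {D D' : Finset (Idx nr nc)} (h : D ⊆ D') (c : Fin nc) : col D c ⊆ col D' c :=
  Finset.filter_subset_filter _ h

lemma pruneMass_eq {K : ℕ} {D A : Finset (Idx nr nc)} (hA : A ⊆ D)
    (hc : ∀ c, (col A c).card = (col D c).card % K) :
    pruneMass K D A = ∏ c, (((col D c).card.choose (col A c).card : ℕ) : ℝ)⁻¹ := by
  refine Finset.prod_congr rfl fun c _ => ?_
  rw [← hc c]
  exact psiSet_one (col_mono hA c) rfl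

/-! ### Sampling within a column -/

section Column

variable {K : ℕ} [NeZero K]

/-- A group of distinct entries of a single column. -/
structure IsGroup (x : Fin K → Idx nr nc) : Prop where
  injective : Function.Injective x
  column : ∀ k, (x k).2 = groupCol x

lemma psiCol_ne_zero {S : Finset (Idx nr nc)} {w : Idx nr nc → ℝ} {x : Fin K → Idx nr nc}
    (h : psiCol S w x ≠ 0) : IsGroup x ∧ entries x ⊆ S := by
  have h' := fun k => draw_ne_zero (Finset.prod_ne_zero_iff.1 h k (Finset.mem_univ k))
  refine ⟨⟨injective_of_notMem_before fun i => (Finset.mem_sdiff.1 (h' i).1).2, fun k => ?_⟩, ?_⟩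
  · rcases eq_or_ne k 0 with rfl | hk
    · rfl
    · have h2 := (h' k).2
      split_ifs at h2 with h3
      · exact h3 0 (Fin.pos_iff_ne_zero.2 hk)
      · exact absurd rfl h2
  · intro e he
    obtain ⟨i, rfl⟩ := mem_entries.1 he
    exact (Finset.mem_sdiff.1 (h' i).1).1

/-- The zeroed weights restrict every later denominator to the column of the group, and the entries
already drawn all lie in that column, so their weights are simply subtracted. -/
lemma psiCol_eq {S : Finset (Idx nr nc)} (w : Idx nr nc → ℝ) {x : Fin K → Idx nr nc}
    (hx : IsGroup x) (hS : entries x ⊆ S) :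
    psiCol S w x = ∏ k, if k = 0 then w (x k) / ∑ e ∈ S, w e
      else w (x k) / (∑ e ∈ col S (groupCol x), w e
        - ∑ j ∈ Finset.univ.filter (fun j : Fin K => j < k), w (x j)) := by
  refine Finset.prod_congr rfl fun k _ => ?_
  have hmem : x k ∈ S \ before x k :=
    Finset.mem_sdiff.2 ⟨hS (apply_mem_entries x k), apply_notMem_before hx.injective k⟩
  rw [draw, if_pos hmem, if_pos fun j _ => by rw [hx.column, hx.column]]
  split_ifs with hk
  · subst hk
    have hb : before x 0 = ∅ := by
      ext e
      simp [mem_before]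
    rw [hb, Finset.sdiff_empty]
    congr 1
    refine Finset.sum_congr rfl fun e _ => if_pos fun j hj => ?_
    simp at hj
  · congr 1
    have hsub : before x k ⊆ col S (groupCol x) := by
      intro e he
      obtain ⟨j, -, rfl⟩ := mem_before.1 he
      exact mem_col.2 ⟨hS (apply_mem_entries x j), hx.column j⟩
    rw [← sum_before hx.injective, ← Finset.sum_sdiff_eq_sub hsub, ← Finset.sum_filter]
    refine Finset.sum_congr ?_ fun _ _ => rfl
    ext e
    simp only [Finset.mem_filter, Finset.mem_sdiff, mem_col]
    constructor
    · rintro ⟨⟨h1, h2⟩, h3⟩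
      exact ⟨⟨h1, h3 0 (Fin.pos_iff_ne_zero.2 hk)⟩, h2⟩
    · rintro ⟨⟨h1, h2⟩, h3⟩
      exact ⟨⟨h1, h3⟩, fun j _ => by rw [h2, hx.column]⟩

/-- The probability that the second to `K`-th uniform draws from a column of `m` elements return
prescribed elements. -/
def laterDraws (K : ℕ) (m : ℝ) : ℝ := ∏ k ∈ Finset.Icc 1 (K - 1), (m - k)⁻¹

lemma psiCol_one {S : Finset (Idx nr nc)} {x : Fin K → Idx nr nc}
    (hx : IsGroup x) (hS : entries x ⊆ S) :
    psiCol S (fun _ => 1) x =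
      (S.card : ℝ)⁻¹ * laterDraws K ((col S (groupCol x)).card : ℝ) := by
  rw [psiCol_eq _ hx hS]
  obtain ⟨K', rfl⟩ : ∃ K', K = K' + 1 := Nat.exists_eq_succ_of_ne_zero (NeZero.ne K)
  rw [Fin.prod_univ_succ]
  congr 1
  · simp
  · rw [laterDraws, Nat.add_sub_cancel, ← Finset.Ico_succ_right_eq_Icc,
      Finset.prod_Ico_eq_prod_range, Nat.succ_eq_succ, Nat.succ_sub_one, ← Fin.prod_univ_eq_prod_range (fun k => _)]
    refine Finset.prod_congr rfl fun k _ => ?_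
    rw [if_neg (Fin.succ_ne_zero k)]
    simp [Finset.filter_gt_eq_Iio, Fin.card_Iio, add_comm]

end Column

/-! ### Families of disjoint groups -/

section Families

variable {K : ℕ} [NeZero K] {ι : Type*}

/-- A family of pairwise disjoint groups. -/
structure IsGroupFamily (x : ι → Fin K → Idx nr nc) : Prop where
  group : ∀ i, IsGroup (x i)
  disjoint : ∀ i j, i ≠ j → Disjoint (entries (x i)) (entries (x j))

lemma IsGroupFamily.comp {κ : Type*} {x : ι → Fin K → Idx nr nc} (hx : IsGroupFamily x)
    {f : κ → ι} (hf : Function.Injective f) : IsGroupFamily (fun k => x (f k)) :=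
  ⟨fun k => hx.group (f k), fun _ _ hkl => hx.disjoint _ _ (hf.ne hkl)⟩

lemma card_biUnion_entries {x : ι → Fin K → Idx nr nc} (hx : IsGroupFamily x) (s : Finset ι) :
    (s.biUnion fun i => entries (x i)).card = K * s.card := by
  rw [Finset.card_biUnion fun i _ j _ hij => hx.disjoint i j hij,
    Finset.sum_congr rfl fun i _ => card_entries (hx.group i).injective, Finset.sum_const,
    smul_eq_mul, mul_comm]

lemma snd_eq_of_mem_entries {x : Fin K → Idx nr nc} (hx : IsGroup x) {e : Idx nr nc}
    (he : e ∈ entries x) : e.2 = groupCol x := by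
  obtain ⟨k, rfl⟩ := mem_entries.1 he
  exact hx.column k

lemma col_biUnion_entries {x : ι → Fin K → Idx nr nc} (hx : IsGroupFamily x) (s : Finset ι)
    (c : Fin nc) : col (s.biUnion fun i => entries (x i)) c =
      (s.filter fun i => groupCol (x i) = c).biUnion fun i => entries (x i) := by
  ext e
  simp only [mem_col, Finset.mem_biUnion, Finset.mem_filter]
  constructor
  · rintro ⟨⟨i, hi, he⟩, hc⟩
    exact ⟨i, ⟨hi, by rw [← snd_eq_of_mem_entries (hx.group i) he, hc]⟩, he⟩
  · rintro ⟨i, ⟨hi, hc⟩, he⟩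
    exact ⟨⟨i, hi, he⟩, by rw [snd_eq_of_mem_entries (hx.group i) he, hc]⟩

lemma card_col_biUnion_entries {x : ι → Fin K → Idx nr nc} (hx : IsGroupFamily x)
    (s : Finset ι) (c : Fin nc) :
    (col (s.biUnion fun i => entries (x i)) c).card
      = K * (s.filter fun i => groupCol (x i) = c).card := by
  rw [col_biUnion_entries hx, card_biUnion_entries hx]

lemma col_sdiff (D E : Finset (Idx nr nc)) (c : Fin nc) : col (D \ E) c = col D c \ col E c := by
  ext e
  simp only [mem_col, Finset.mem_sdiff]
  tauto

lemma card_col_sdiff {D E : Finset (Idx nr nc)} (h : E ⊆ D) (c : Fin nc) :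
    ((col (D \ E) c).card : ℝ) = (col D c).card - (col E c).card := by
  rw [col_sdiff, Finset.cast_card_sdiff (col_mono h c)]

/-- The ranks of the indices among those with the same label run through initial segments. -/
lemma prod_rank_eq {α : Type*} [Fintype α] [DecidableEq α] (φ : α → ℕ → ℝ) {n : ℕ}
    (c : Fin n → α) :
    ∏ i, φ (c i) ((Finset.univ.filter fun j => j < i).filter fun j => c j = c i).card
      = ∏ a, ∏ t ∈ Finset.range (Finset.univ.filter fun i => c i = a).card, φ a t := by
  induction n with
  | zero => simp
  | succ n ih =>
    -- Dropping the last index leaves all other ranks unchanged; the rank of the last index counts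
    -- all earlier indices with its label.
    have h1 : ∀ i : Fin n, ((Finset.univ.filter fun j : Fin (n + 1) => j < i.castSucc).filter
        fun j => c j = c i.castSucc).card
        = ((Finset.univ.filter fun j => j < i).filter fun j => c j.castSucc = c i.castSucc).card := by
      intro i
      rw [Finset.filter_filter, Finset.filter_filter, Finset.card_filter, Finset.card_filter,
        Fin.sum_univ_castSucc]
      simp [(Fin.le_last i.castSucc).not_gt]
    have h2 : ((Finset.univ.filter fun j : Fin (n + 1) => j < Fin.last n).filter
        fun j => c j = c (Fin.last n)).card
        = (Finset.univ.filter fun j : Fin n => c j.castSucc = c (Fin.last n)).card := by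
      rw [Finset.filter_filter, Finset.card_filter, Finset.card_filter, Fin.sum_univ_castSucc]
      simp [Fin.castSucc_lt_last]
    have h3 : ∀ a, (Finset.univ.filter fun i => c i = a).card
        = (Finset.univ.filter fun i : Fin n => c i.castSucc = a).card
          + if c (Fin.last n) = a then 1 else 0 := by
      intro a
      rw [Finset.card_filter, Finset.card_filter, Fin.sum_univ_castSucc]
    rw [Fin.prod_univ_castSucc, h2]
    simp_rw [h1]
    rw [ih fun i => c i.castSucc]
    simp_rw [h3]
    have h4 : ∀ a, ∏ t ∈ Finset.range ((Finset.univ.filter fun i : Fin n => c i.castSucc = a).card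
          + if c (Fin.last n) = a then 1 else 0), φ a t
        = (∏ t ∈ Finset.range (Finset.univ.filter fun i : Fin n => c i.castSucc = a).card, φ a t)
          * if c (Fin.last n) = a then
            φ a (Finset.univ.filter fun i : Fin n => c i.castSucc = a).card else 1 := by
      intro a
      split_ifs
      · rw [Finset.prod_range_succ]
      · simp
    simp_rw [h4]
    rw [Finset.prod_mul_distrib, Finset.prod_ite_eq]
    simp

variable {n : ℕ}

lemma calMass_ne_zero {S : Finset (Idx nr nc)} {x : Fin n → Fin K → Idx nr nc}
    (h : calMass S x ≠ 0) : IsGroupFamily x ∧ groupEntries x ⊆ S := by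
  have h' := fun i => psiCol_ne_zero (Finset.prod_ne_zero_iff.1 h i (Finset.mem_univ i))
  have hlt : ∀ i j, j < i → Disjoint (entries (x i)) (entries (x j)) := by
    intro i j hji
    rw [Finset.disjoint_left]
    intro e hi hj
    refine (Finset.mem_sdiff.1 ((h' i).2 hi)).2 (Finset.mem_biUnion.2 ⟨j, ?_, hj⟩)
    simpa using hji
  refine ⟨⟨fun i => (h' i).1, fun i j hij => ?_⟩, ?_⟩
  · rcases hij.lt_or_gt with hl | hl
    · exact (hlt j i hl).symm
    · exact hlt i j hl
  · intro e he
    obtain ⟨i, -, hi⟩ := Finset.mem_biUnion.1 he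
    exact (Finset.mem_sdiff.1 ((h' i).2 hi)).1

/-- When group `i` is drawn, `K * i` entries are gone overall and `K * t` from its column, with `t`
its rank among the groups of that column. Collecting the ranks by column with `prod_rank_eq` makes
the order of the groups disappear. -/
lemma calMass_eq {S : Finset (Idx nr nc)} {x : Fin n → Fin K → Idx nr nc}
    (hx : IsGroupFamily x) (hS : groupEntries x ⊆ S) :
    calMass S x = (∏ i : Fin n, ((S.card : ℝ) - K * (i : ℕ))⁻¹) *
      ∏ c, ∏ t ∈ Finset.range (Finset.univ.filter fun i => groupCol (x i) = c).card,
        laterDraws K (((col S c).card : ℝ) - K * t) := by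
  rw [← prod_rank_eq (fun c t => laterDraws K (((col S c).card : ℝ) - K * t))
    (fun i => groupCol (x i)), ← Finset.prod_mul_distrib]
  refine Finset.prod_congr rfl fun i _ => ?_
  set s : Finset (Fin n) := Finset.univ.filter fun j => j < i with hs
  have hsub : (s.biUnion fun j => entries (x j)) ⊆ S :=
    (Finset.biUnion_subset_biUnion_of_subset_left _ (Finset.subset_univ _)).trans hS
  have hcard : s.card = i := by rw [hs, Finset.filter_gt_eq_Iio, Fin.card_Iio]
  have hi : entries (x i) ⊆ S \ s.biUnion fun j => entries (x j) := by
    intro e he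
    refine Finset.mem_sdiff.2 ⟨hS (Finset.mem_biUnion.2 ⟨i, Finset.mem_univ _, he⟩), ?_⟩
    intro h
    obtain ⟨j, hj, hej⟩ := Finset.mem_biUnion.1 h
    have hji : j < i := by simpa [hs] using hj
    exact Finset.disjoint_left.1 (hx.disjoint i j hji.ne') he hej
  rw [psiCol_one (hx.group i) hi, card_col_sdiff hsub, card_col_biUnion_entries hx,
    Finset.cast_card_sdiff hsub, card_biUnion_entries hx, hcard]
  push_cast
  rfl

end Families

/-! ### Exchanging the test group with a calibration group -/

section Exchange

variable {n K : ℕ} [NeZero K]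

/-- The groups are disjoint and unobserved in the training set, and the pruned set is compatible
with them: these are the configurations of positive probability, up to the weights. -/
structure IsAdmissible (D₁ D₀ : Finset (Idx nr nc)) (g : Fin (n + 1) → Fin K → Idx nr nc) :
    Prop where
  family : IsGroupFamily g
  disjoint : ∀ i, Disjoint (entries (g i)) D₁
  subset : D₀ ⊆ D₁
  card_col : ∀ c, (col D₀ c).card = (col D₁ c).card % K

/-- The observed set when the training set is `D₁` and `g j` is the test group. -/
def obsAt (D₁ : Finset (Idx nr nc)) (g : Fin (n + 1) → Fin K → Idx nr nc) (j : Fin (n + 1)) :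
    Finset (Idx nr nc) :=
  D₁ ∪ (Finset.univ.erase j).biUnion fun i => entries (g i)

/-- The number of calibration groups in column `c` when `g j` is the test group. -/
def countAt (g : Fin (n + 1) → Fin K → Idx nr nc) (j : Fin (n + 1)) (c : Fin nc) : ℕ :=
  ((Finset.univ.erase j).filter fun i => groupCol (g i) = c).card

lemma isAdmissible_comp_perm_iff {D₁ D₀ : Finset (Idx nr nc)}
    {g : Fin (n + 1) → Fin K → Idx nr nc} (σ : Equiv.Perm (Fin (n + 1))) :
    IsAdmissible D₁ D₀ (fun i => g (σ i)) ↔ IsAdmissible D₁ D₀ g := by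
  have key : ∀ {g : Fin (n + 1) → Fin K → Idx nr nc} (σ : Equiv.Perm (Fin (n + 1))),
      IsAdmissible D₁ D₀ g → IsAdmissible D₁ D₀ (fun i => g (σ i)) := fun σ h =>
    ⟨h.family.comp σ.injective, fun i => h.disjoint _, h.subset, h.card_col⟩
  refine ⟨fun h => ?_, key σ⟩
  simpa using key σ.symm h

omit [NeZero K] in
lemma obsAt_comp_perm (D₁ : Finset (Idx nr nc)) (g : Fin (n + 1) → Fin K → Idx nr nc)
    (σ : Equiv.Perm (Fin (n + 1))) (j : Fin (n + 1)) :
    obsAt D₁ (fun i => g (σ i)) j = obsAt D₁ g (σ j) := by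
  unfold obsAt
  congr 1
  ext e
  simp only [Finset.mem_biUnion, Finset.mem_erase, Finset.mem_univ, and_true]
  constructor
  · rintro ⟨i, hi, he⟩
    exact ⟨σ i, σ.injective.ne hi, he⟩
  · rintro ⟨i, hi, he⟩
    exact ⟨σ.symm i, fun h => hi (by rw [← h, σ.apply_symm_apply]), by simpa using he⟩

lemma countAt_add (g : Fin (n + 1) → Fin K → Idx nr nc) (j : Fin (n + 1)) (c : Fin nc) :
    countAt g j c + (if groupCol (g j) = c then 1 else 0)
      = (Finset.univ.filter fun i => groupCol (g i) = c).card := by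
  rw [countAt, Finset.card_filter, Finset.card_filter, Finset.sum_erase_add _ _ (Finset.mem_univ j)]

lemma countAt_comp_perm (g : Fin (n + 1) → Fin K → Idx nr nc)
    (σ : Equiv.Perm (Fin (n + 1))) (j : Fin (n + 1)) (c : Fin nc) :
    countAt (fun i => g (σ i)) j c = countAt g (σ j) c := by
  have h1 := countAt_add (fun i => g (σ i)) j c
  have h2 := countAt_add g (σ j) c
  have h3 : (Finset.univ.filter fun i => groupCol (g (σ i)) = c).card
      = (Finset.univ.filter fun i => groupCol (g i) = c).card := by
    rw [Finset.card_filter, Finset.card_filter]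
    exact Equiv.sum_comp σ fun i => if groupCol (g i) = c then 1 else 0
  omega

lemma erase_last_eq_map :
    (Finset.univ : Finset (Fin (n + 1))).erase (Fin.last n)
      = Finset.univ.map Fin.castSuccEmb := by
  ext i
  induction i using Fin.lastCases <;> simp [Fin.castSucc_ne_last]

omit [NeZero K] in
lemma groupEntries_castSucc (g : Fin (n + 1) → Fin K → Idx nr nc) :
    groupEntries (fun i : Fin n => g i.castSucc)
      = (Finset.univ.erase (Fin.last n)).biUnion fun i => entries (g i) := by
  rw [erase_last_eq_map, Finset.map_eq_image, Finset.image_biUnion]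
  rfl

lemma countAt_last (g : Fin (n + 1) → Fin K → Idx nr nc) (c : Fin nc) :
    countAt g (Fin.last n) c
      = (Finset.univ.filter fun i : Fin n => groupCol (g i.castSucc) = c).card := by
  rw [countAt, erase_last_eq_map, Finset.filter_map, Finset.card_map]
  rfl

variable {D₁ D₀ : Finset (Idx nr nc)} {g : Fin (n + 1) → Fin K → Idx nr nc}

lemma IsAdmissible.disjoint_biUnion (hg : IsAdmissible D₁ D₀ g) (s : Finset (Fin (n + 1))) :
    Disjoint D₁ (s.biUnion fun i => entries (g i)) :=
  (Finset.disjoint_biUnion_right _ _ _).2 fun i _ => (hg.disjoint i).symm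

lemma IsAdmissible.card_col_obsAt (hg : IsAdmissible D₁ D₀ g) (j : Fin (n + 1)) (c : Fin nc) :
    (col (obsAt D₁ g j) c).card = (col D₁ c).card + K * countAt g j c := by
  rw [countAt, ← card_col_biUnion_entries hg.family, obsAt, col, Finset.filter_union,
    Finset.card_union_of_disjoint]
  · rfl
  · exact Finset.disjoint_filter_filter (hg.disjoint_biUnion _)

lemma IsAdmissible.card_obsAt (hg : IsAdmissible D₁ D₀ g) (j : Fin (n + 1)) :
    (obsAt D₁ g j).card = D₁.card + K * n := by
  rw [obsAt, Finset.card_union_of_disjoint (hg.disjoint_biUnion _), card_biUnion_entries hg.family]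
  simp

lemma IsAdmissible.col_le (hg : IsAdmissible D₁ D₀ g) (c : Fin nc) :
    (col D₀ c).card ≤ (col D₁ c).card :=
  Finset.card_le_card (col_mono hg.subset c)

variable (K) in
/-- The contribution to the law of the calibration algorithm of a column with `t` groups. -/
def columnMass (D₁ D₀ : Finset (Idx nr nc)) (c : Fin nc) (t : ℕ) : ℝ :=
  ((((col D₁ c).card + K * t).choose (col D₀ c).card : ℕ) : ℝ)⁻¹ *
    ∏ s ∈ Finset.range t,
      laterDraws K (((col D₁ c).card : ℝ) - (col D₀ c).card + K * (s + 1 : ℕ))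

variable (n K) in
/-- The probability that the first entries of `n` groups are prescribed elements. -/
def firstDraws (D₁ D₀ : Finset (Idx nr nc)) : ℝ :=
  ∏ i : Fin n, ((D₁.card : ℝ) - D₀.card + K * n - K * (i : ℕ))⁻¹

/-- The right side sees the groups only through the column counts, which is the source of
exchangeability. The pruned sizes do not depend on the groups either, since each group adds `K`
entries to one column. -/
lemma IsAdmissible.pruneMass_mul_calMass (hg : IsAdmissible D₁ D₀ g) :
    pruneMass K (obsAt D₁ g (Fin.last n)) D₀
        * calMass (obsAt D₁ g (Fin.last n) \ D₀) (fun i : Fin n => g i.castSucc)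
      = firstDraws n K D₁ D₀ * ∏ c, columnMass K D₁ D₀ c (countAt g (Fin.last n) c) := by
  have hsub : D₀ ⊆ obsAt D₁ g (Fin.last n) := hg.subset.trans Finset.subset_union_left
  have hS : groupEntries (fun i : Fin n => g i.castSucc) ⊆ obsAt D₁ g (Fin.last n) \ D₀ := by
    rw [groupEntries_castSucc]
    intro e he
    refine Finset.mem_sdiff.2 ⟨Finset.mem_union_right _ he, fun h => ?_⟩
    exact Finset.disjoint_left.1 (hg.disjoint_biUnion _) (hg.subset h) he
  rw [pruneMass_eq hsub fun c => by
      rw [hg.card_col_obsAt, Nat.add_mul_mod_self_left, hg.card_col],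
    calMass_eq (hg.family.comp (Fin.castSucc_injective n)) hS, mul_left_comm,
    ← Finset.prod_mul_distrib]
  congr 1
  · refine Finset.prod_congr rfl fun i _ => ?_
    rw [Finset.cast_card_sdiff hsub, hg.card_obsAt]
    push_cast
    ring
  · refine Finset.prod_congr rfl fun c _ => ?_
    rw [columnMass, hg.card_col_obsAt, ← countAt_last]
    congr 1
    -- Counting the groups of a column from the last drawn makes the factors independent of the
    -- total count, so that one more group just appends a factor to `columnMass`.
    refine (Finset.prod_range_reflect _ _).symm.trans ?_
    refine Finset.prod_congr rfl fun t ht => ?_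
    have ht' : t + 1 ≤ countAt g (Fin.last n) c := by simpa using ht
    rw [card_col_sdiff hsub, hg.card_col_obsAt,
      show countAt g (Fin.last n) c - 1 - t = countAt g (Fin.last n) c - (t + 1) by omega]
    congr 1
    rw [Nat.cast_sub ht']
    push_cast
    ring

lemma laterDraws_ne_zero {m : ℝ} (hm : (K : ℝ) ≤ m) : laterDraws K m ≠ 0 := by
  refine Finset.prod_ne_zero_iff.2 fun k hk => inv_ne_zero (sub_ne_zero.2 ?_)
  have hk' : k < K := by
    have := Finset.mem_Icc.1 hk
    have := NeZero.pos K
    omega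
  have : (k : ℝ) < K := by exact_mod_cast hk'
  exact (this.trans_le hm).ne'

lemma IsAdmissible.laterDraws_ne_zero (hg : IsAdmissible D₁ D₀ g) (c : Fin nc) (s : ℕ) :
    laterDraws K (((col D₁ c).card : ℝ) - (col D₀ c).card + K * (s + 1 : ℕ)) ≠ 0 := by
  refine SCMC.laterDraws_ne_zero ?_
  have h1 : ((col D₀ c).card : ℝ) ≤ (col D₁ c).card := by exact_mod_cast hg.col_le c
  have h2 : (0 : ℝ) ≤ K * s := by positivity
  push_cast
  linarith

lemma IsAdmissible.choose_ne_zero (hg : IsAdmissible D₁ D₀ g) (c : Fin nc) (t : ℕ) :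
    ((((col D₁ c).card + K * t).choose (col D₀ c).card : ℕ) : ℝ) ≠ 0 := by
  have := hg.col_le c
  exact_mod_cast (Nat.choose_pos (by omega)).ne'

lemma IsAdmissible.firstDraws_mul_ne_zero (hg : IsAdmissible D₁ D₀ g) (t : Fin nc → ℕ) :
    firstDraws n K D₁ D₀ * ∏ c, columnMass K D₁ D₀ c (t c) ≠ 0 := by
  refine mul_ne_zero (Finset.prod_ne_zero_iff.2 fun i _ => inv_ne_zero ?_)
    (Finset.prod_ne_zero_iff.2 fun c _ => mul_ne_zero (inv_ne_zero (hg.choose_ne_zero c _))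
      (Finset.prod_ne_zero_iff.2 fun s _ => hg.laterDraws_ne_zero c s))
  have h1 : (D₀.card : ℝ) ≤ D₁.card := by exact_mod_cast Finset.card_le_card hg.subset
  have h2 : ((i : ℕ) : ℝ) < n := by exact_mod_cast i.2
  have h3 : (0 : ℝ) < K := by exact_mod_cast NeZero.pos K
  nlinarith

lemma IsAdmissible.columnMass_succ (hg : IsAdmissible D₁ D₀ g) (c : Fin nc) (t : ℕ) :
    columnMass K D₁ D₀ c (t + 1) = columnMass K D₁ D₀ c t *
      ((((col D₁ c).card + K * t).choose (col D₀ c).card : ℕ) /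
        (((col D₁ c).card + K * (t + 1)).choose (col D₀ c).card : ℕ) *
        laterDraws K (((col D₁ c).card : ℝ) - (col D₀ c).card + K * (t + 1 : ℕ))) := by
  have h1 := hg.choose_ne_zero c t
  have h2 := hg.choose_ne_zero c (t + 1)
  rw [columnMass, columnMass, Finset.prod_range_succ]
  field_simp

lemma IsAdmissible.columnMass_eq_succ_mul (hg : IsAdmissible D₁ D₀ g) (c : Fin nc) (t : ℕ) :
    columnMass K D₁ D₀ c t = columnMass K D₁ D₀ c (t + 1) *
      ((((col D₁ c).card + K * (t + 1)).choose (col D₀ c).card : ℕ) /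
        (((col D₁ c).card + K * t).choose (col D₀ c).card : ℕ) *
        (laterDraws K (((col D₁ c).card : ℝ) - (col D₀ c).card + K * (t + 1 : ℕ)))⁻¹) := by
  have h1 := hg.choose_ne_zero c t
  have h2 := hg.choose_ne_zero c (t + 1)
  have h3 := hg.laterDraws_ne_zero c t
  rw [hg.columnMass_succ]
  field_simp

lemma IsAdmissible.nBar_obsAt (hg : IsAdmissible D₁ D₀ g) (j : Fin (n + 1)) (c : Fin nc) :
    nBar K (obsAt D₁ g j) c = (col D₁ c).card + K * countAt g j c - (col D₀ c).card := by
  rw [nBar, nObs, hg.card_col_obsAt, Nat.add_mul_mod_self_left, hg.card_col]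

/-- The first bracket is the effect on `columnMass` of removing a group from column `c`, the second
that of adding one to `c'`. -/
lemma IsAdmissible.colFactor_eq (hg : IsAdmissible D₁ D₀ g) {j : Fin (n + 1)} {c c' : Fin nc}
    {t : ℕ} (ht : countAt g j c = t + 1) :
    colFactor K (obsAt D₁ g j) c c' =
      ((((col D₁ c).card + K * (t + 1)).choose (col D₀ c).card : ℕ) /
        (((col D₁ c).card + K * t).choose (col D₀ c).card : ℕ) *
        (laterDraws K (((col D₁ c).card : ℝ) - (col D₀ c).card + K * (t + 1 : ℕ)))⁻¹) *
      ((((col D₁ c').card + K * countAt g j c').choose (col D₀ c').card : ℕ) /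
        (((col D₁ c').card + K * (countAt g j c' + 1)).choose (col D₀ c').card : ℕ) *
        laterDraws K (((col D₁ c').card : ℝ) - (col D₀ c').card
          + K * (countAt g j c' + 1 : ℕ))) := by
  have hc := hg.col_le c
  have hc' := hg.col_le c'
  set b := (col D₁ c).card
  set r := (col D₀ c).card
  set b' := (col D₁ c').card
  set r' := (col D₀ c').card
  set t' := countAt g j c' with ht'
  -- Choosing the kept entries amounts to choosing the `r` pruned ones. As column `c` contains a
  -- calibration group, the subtractions of `K` do not truncate.
  have e1 : (b + K * (t + 1)).choose (b + K * (t + 1) - r) = (b + K * (t + 1)).choose r :=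
    Nat.choose_symm (by omega)
  have e2 : (b + K * (t + 1) - K).choose (b + K * (t + 1) - r - K) = (b + K * t).choose r := by
    rw [show b + K * (t + 1) - K = b + K * t by rw [mul_add]; omega,
      show b + K * (t + 1) - r - K = b + K * t - r by rw [mul_add]; omega]
    exact Nat.choose_symm (by omega)
  have e3 : (b' + K * t').choose (b' + K * t' - r') = (b' + K * t').choose r' :=
    Nat.choose_symm (by omega)
  have e4 : (b' + K * t' + K).choose (b' + K * t' - r' + K) = (b' + K * (t' + 1)).choose r' := by
    rw [show b' + K * t' + K = b' + K * (t' + 1) by ring,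
      show b' + K * t' - r' + K = b' + K * (t' + 1) - r' by rw [mul_add]; omega]
    exact Nat.choose_symm (by omega)
  rw [colFactor, nObs, nObs, hg.nBar_obsAt, hg.nBar_obsAt, hg.card_col_obsAt, hg.card_col_obsAt,
    ht, ← ht', e1, e2, e3, e4, laterDraws, laterDraws, ← Finset.prod_inv_distrib, mul_assoc,
    mul_assoc]
  congr 1
  rw [mul_left_comm]
  congr 1
  rw [← Finset.prod_mul_distrib]
  refine Finset.prod_congr rfl fun k _ => ?_
  rw [inv_inv, Nat.cast_sub (by omega), Nat.cast_sub (by omega), div_eq_mul_inv]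
  push_cast
  simp only [b, r, b', r']
  ring_nf

/-- Only the columns of `g i` and `g j` can change their counts, and neither does if they coincide.
-/
lemma IsAdmissible.prod_columnMass_exchange (hg : IsAdmissible D₁ D₀ g) (i j : Fin (n + 1)) :
    (if groupCol (g i) = groupCol (g j) then 1
        else colFactor K (obsAt D₁ g j) (groupCol (g i)) (groupCol (g j)))
        * ∏ c, columnMass K D₁ D₀ c (countAt g j c)
      = ∏ c, columnMass K D₁ D₀ c (countAt g i c) := by
  have hcount : ∀ c, countAt g j c + (if groupCol (g j) = c then 1 else 0)
      = countAt g i c + (if groupCol (g i) = c then 1 else 0) := fun c => by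
    rw [countAt_add, countAt_add]
  split_ifs with h
  · rw [one_mul]
    refine Finset.prod_congr rfl fun c _ => ?_
    have := hcount c
    rw [h] at this
    rw [Nat.add_right_cancel this]
  · have hi : countAt g j (groupCol (g i)) = countAt g i (groupCol (g i)) + 1 := by
      have := hcount (groupCol (g i))
      rwa [if_neg (Ne.symm h), if_pos rfl, add_zero] at this
    have hj : countAt g i (groupCol (g j)) = countAt g j (groupCol (g j)) + 1 := by
      have := hcount (groupCol (g j))
      rw [if_pos rfl, if_neg h, add_zero] at this
      exact this.symm
    rw [hg.colFactor_eq hi]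
    set R₁ : ℝ := _ * (laterDraws K _)⁻¹ with hR₁
    set R₂ : ℝ := _ / _ * laterDraws K _ with hR₂
    have hterm : ∀ c, columnMass K D₁ D₀ c (countAt g i c)
        = (if c = groupCol (g i) then R₁ else 1) * (if c = groupCol (g j) then R₂ else 1)
          * columnMass K D₁ D₀ c (countAt g j c) := by
      intro c
      by_cases h1 : c = groupCol (g i)
      · subst h1
        rw [if_pos rfl, if_neg h, hi, hg.columnMass_eq_succ_mul]
        ring
      · by_cases h2 : c = groupCol (g j)
        · subst h2
          rw [if_neg h1, if_pos rfl, hj, hg.columnMass_succ]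
          ring
        · have := hcount c
          rw [if_neg (Ne.symm h1), if_neg (Ne.symm h2)] at this
          rw [if_neg h1, if_neg h2, one_mul, one_mul, Nat.add_right_cancel this]
    simp_rw [hterm]
    rw [Finset.prod_mul_distrib, Finset.prod_mul_distrib, Finset.prod_ite_eq', Finset.prod_ite_eq',
      if_pos (Finset.mem_univ _), if_pos (Finset.mem_univ _)]

end Exchange

/-! ### Masses of exchanged configurations and the conformalization weights. -/

section ExchangeMass

variable {n K : ℕ} [NeZero K] {D₁ D₀ : Finset (Idx nr nc)} {g : Fin (n + 1) → Fin K → Idx nr nc}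

/-- The entries that are neither in the training set nor in a group. -/
def unused (D₁ : Finset (Idx nr nc)) (g : Fin (n + 1) → Fin K → Idx nr nc) :
    Finset (Idx nr nc) :=
  (D₁ ∪ Finset.univ.biUnion fun i => entries (g i))ᶜ

omit [NeZero K] in
lemma disjoint_unused (j : Fin (n + 1)) :
    Disjoint (unused D₁ g) (entries (g j)) := by
  rw [unused, Finset.disjoint_left]
  intro e he hj
  simp only [Finset.mem_compl, Finset.mem_union, Finset.mem_biUnion, not_or] at he
  exact he.2 ⟨j, Finset.mem_univ j, hj⟩

/-- The unused entries do not depend on `j`, so a change of test group alters the missing set by one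
group only; all denominators are compared through this decomposition. -/
lemma IsAdmissible.compl_obsAt (hg : IsAdmissible D₁ D₀ g) (j : Fin (n + 1)) :
    (obsAt D₁ g j)ᶜ = unused D₁ g ∪ entries (g j) := by
  ext e
  simp only [obsAt, unused, Finset.mem_compl, Finset.mem_union, Finset.mem_biUnion,
    Finset.mem_erase, Finset.mem_univ, and_true, true_and, not_or, not_exists, not_and]
  constructor
  · rintro ⟨h1, h2⟩
    by_cases hj : e ∈ entries (g j)
    · exact Or.inr hj
    · refine Or.inl ⟨h1, fun i hi => ?_⟩
      rcases eq_or_ne i j with rfl | hij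
      · exact hj hi
      · exact h2 i hij hi
  · rintro (⟨h1, h2⟩ | hj)
    · exact ⟨h1, fun i _ => h2 i⟩
    · exact ⟨Finset.disjoint_left.1 (hg.disjoint j) hj,
        fun i hij hi => Finset.disjoint_left.1 (hg.family.disjoint i j hij) hi hj⟩

lemma IsAdmissible.sum_compl_obsAt (hg : IsAdmissible D₁ D₀ g) (v : Idx nr nc → ℝ)
    (j : Fin (n + 1)) :
    ∑ e ∈ (obsAt D₁ g j)ᶜ, v e = ∑ e ∈ unused D₁ g, v e + ∑ k, v (g j k) := by
  rw [hg.compl_obsAt, Finset.sum_union (disjoint_unused j),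
    sum_entries (hg.family.group j).injective]

lemma IsAdmissible.sum_col_compl_obsAt (hg : IsAdmissible D₁ D₀ g) (v : Idx nr nc → ℝ)
    (j : Fin (n + 1)) (c : Fin nc) :
    ∑ e ∈ col (obsAt D₁ g j)ᶜ c, v e = ∑ e ∈ col (unused D₁ g) c, v e
      + if groupCol (g j) = c then ∑ k, v (g j k) else 0 := by
  rw [hg.compl_obsAt, col, Finset.filter_union, Finset.sum_union
    (Finset.disjoint_filter_filter (disjoint_unused j))]
  congr 1
  split_ifs with h
  · rw [Finset.filter_true_of_mem fun e he => by
      rw [snd_eq_of_mem_entries (hg.family.group j) he, h],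
      sum_entries (hg.family.group j).injective]
  · rw [Finset.filter_false_of_mem fun e he => by
      rwa [snd_eq_of_mem_entries (hg.family.group j) he], Finset.sum_empty]

lemma IsAdmissible.swapObs_obsAt (hg : IsAdmissible D₁ D₀ g) (i : Fin (n + 1)) :
    swapObs (obsAt D₁ g (Fin.last n)) g i = obsAt D₁ g i := by
  rw [swapObs]
  split_ifs with h
  · rw [h]
  · have hd := disjoint_unused (D₁ := D₁) (g := g) (Fin.last n)
    ext e
    have h1 := fun h : e ∈ unused D₁ g => Finset.disjoint_left.1 hd h
    have h2 := Finset.ext_iff.1 (hg.compl_obsAt i) e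
    have h3 := Finset.ext_iff.1 (hg.compl_obsAt (Fin.last n)) e
    simp only [Finset.mem_union, Finset.mem_compl, Finset.mem_sdiff] at h2 h3 ⊢
    tauto

lemma IsAdmissible.col_subset (hg : IsAdmissible D₁ D₀ g) (i : Fin (n + 1)) :
    entries (g i) ⊆ col (obsAt D₁ g i)ᶜ (groupCol (g i)) := by
  intro e he
  refine mem_col.2 ⟨?_, snd_eq_of_mem_entries (hg.family.group i) he⟩
  rw [hg.compl_obsAt]
  exact Finset.mem_union_right _ he

lemma IsAdmissible.le_card_col (hg : IsAdmissible D₁ D₀ g) (i : Fin (n + 1)) :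
    K ≤ (col (obsAt D₁ g i)ᶜ (groupCol (g i))).card := by
  have := Finset.card_le_card (hg.col_subset i)
  rwa [card_entries (hg.family.group i).injective] at this

omit [NeZero K] in
lemma mem_prunedMiss {D : Finset (Idx nr nc)} {e : Idx nr nc} :
    e ∈ prunedMiss K D ↔ e ∈ Dᶜ ∧ K ≤ (col Dᶜ e.2).card := by
  simp [prunedMiss]

/-- The column of `g i` holds the `K` missing entries of `g i` itself, so it survives the
restriction to `prunedMiss`, which therefore affects the first denominator only. -/
lemma IsAdmissible.psiCol_prunedMiss (hg : IsAdmissible D₁ D₀ g) (wstar : Idx nr nc → ℝ)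
    (i : Fin (n + 1)) :
    psiCol (prunedMiss K (obsAt D₁ g i)) wstar (g i)
      = ∏ k, testWeight wstar (obsAt D₁ g (Fin.last n)) g
          (firstDenomPruned wstar (obsAt D₁ g (Fin.last n)) g i) i k := by
  have hsub : entries (g i) ⊆ prunedMiss K (obsAt D₁ g i) := by
    intro e he
    have h := mem_col.1 (hg.col_subset i he)
    exact mem_prunedMiss.2 ⟨h.1, h.2 ▸ hg.le_card_col i⟩
  have hcol : col (prunedMiss K (obsAt D₁ g i)) (groupCol (g i))
      = col (obsAt D₁ g i)ᶜ (groupCol (g i)) := by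
    ext e
    rw [mem_col, mem_prunedMiss, mem_col]
    constructor
    · rintro ⟨⟨h1, -⟩, h3⟩
      exact ⟨h1, h3⟩
    · rintro ⟨h1, h3⟩
      exact ⟨⟨h1, h3 ▸ hg.le_card_col i⟩, h3⟩
  rw [psiCol_eq _ (hg.family.group i) hsub]
  refine Finset.prod_congr rfl fun k _ => ?_
  rw [testWeight, firstDenomPruned, hg.swapObs_obsAt]
  congr 2
  -- Both sides reduce to the unused weight of the column plus the weights of the draws from `k` on.
  -- The term subtracted in `laterDenom` removes the last group, which is missing in the actual
  -- configuration but observed after the exchange.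
  rw [laterDenom, hcol, hg.sum_col_compl_obsAt, hg.sum_col_compl_obsAt, if_pos rfl,
    ← Finset.sum_filter_add_sum_filter_not Finset.univ (fun j : Fin K => j < k)]
  simp only [not_lt]
  simp only [eq_comm (a := groupCol (g (Fin.last n)))]
  ring

lemma IsAdmissible.firstDenom_eq (hg : IsAdmissible D₁ D₀ g) (wstar : Idx nr nc → ℝ)
    (i : Fin (n + 1)) :
    firstDenom wstar (obsAt D₁ g (Fin.last n)) g i = ∑ e ∈ (obsAt D₁ g i)ᶜ, wstar e := by
  rw [firstDenom, hg.sum_compl_obsAt, hg.sum_compl_obsAt, Finset.sum_sub_distrib]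
  ring

lemma IsAdmissible.firstDenom_eq_pruned (hg : IsAdmissible D₁ D₀ g) (wstar : Idx nr nc → ℝ)
    {i : Fin (n + 1)} (h : ∀ c, K ≤ (col (obsAt D₁ g i)ᶜ c).card) :
    firstDenom wstar (obsAt D₁ g (Fin.last n)) g i
      = firstDenomPruned wstar (obsAt D₁ g (Fin.last n)) g i := by
  rw [hg.firstDenom_eq, firstDenomPruned, hg.swapObs_obsAt, prunedMiss,
    Finset.filter_true_of_mem fun e _ => h e.2]

/-- The joint law of the observed set, the pruned set, the calibration groups and the test
group. -/
def jointMass (nobs : ℕ) (w wstar : Idx nr nc → ℝ) (D A : Finset (Idx nr nc))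
    (x : Fin n → Fin K → Idx nr nc) (y : Fin K → Idx nr nc) : ℝ :=
  psiSet nobs Finset.univ w D * pruneMass K D A * calMass (D \ A) x
    * psiCol (prunedMiss K D) wstar y

open scoped Classical in
/-- The probability of the training set `D₁`, the pruned set `D₀` and the groups `g`, where `g j`
is the test group. -/
def exchangeMass (nobs : ℕ) (w wstar : Idx nr nc → ℝ) (D₁ D₀ : Finset (Idx nr nc))
    (g : Fin (n + 1) → Fin K → Idx nr nc) (j : Fin (n + 1)) : ℝ :=
  if IsAdmissible D₁ D₀ g then
    psiSet nobs Finset.univ w (obsAt D₁ g j)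
      * (firstDraws n K D₁ D₀ * ∏ c, columnMass K D₁ D₀ c (countAt g j c))
      * psiCol (prunedMiss K (obsAt D₁ g j)) wstar (g j)
  else 0

variable (nobs : ℕ) (w wstar : Idx nr nc → ℝ)

/-- Weighted exchangeability: admissibility is symmetric, and the mass depends on the order of the
groups only through which of them is the test group. -/
lemma exchangeMass_comp_perm (D₁ D₀ : Finset (Idx nr nc)) (g : Fin (n + 1) → Fin K → Idx nr nc)
    (σ : Equiv.Perm (Fin (n + 1))) (j : Fin (n + 1)) :
    exchangeMass nobs w wstar D₁ D₀ (fun i => g (σ i)) j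
      = exchangeMass nobs w wstar D₁ D₀ g (σ j) := by
  classical
  simp only [exchangeMass, obsAt_comp_perm, countAt_comp_perm]
  exact if_congr (isAdmissible_comp_perm_iff σ) rfl rfl

lemma IsAdmissible.exchangeMass_last (hg : IsAdmissible D₁ D₀ g) :
    exchangeMass nobs w wstar D₁ D₀ g (Fin.last n)
      = jointMass nobs w wstar (obsAt D₁ g (Fin.last n)) D₀ (fun i : Fin n => g i.castSucc)
          (g (Fin.last n)) := by
  rw [exchangeMass, if_pos hg, jointMass, ← hg.pruneMass_mul_calMass]
  ring

/-- The multiplier is the law of the pruning and calibration in the actual configuration. It does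
not depend on `i` and so cancels on normalization. -/
lemma IsAdmissible.rawWeight_mul (hg : IsAdmissible D₁ D₀ g) (i : Fin (n + 1)) :
    rawWeight nobs w wstar (obsAt D₁ g (Fin.last n)) g
        (firstDenomPruned wstar (obsAt D₁ g (Fin.last n)) g) i
        * (firstDraws n K D₁ D₀ * ∏ c, columnMass K D₁ D₀ c (countAt g (Fin.last n) c))
      = exchangeMass nobs w wstar D₁ D₀ g i := by
  rw [exchangeMass, if_pos hg, rawWeight, hg.swapObs_obsAt, ← hg.psiCol_prunedMiss,
    ← hg.prod_columnMass_exchange i (Fin.last n)]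
  ring

lemma IsAdmissible.confWeightPruned_eq (hg : IsAdmissible D₁ D₀ g) (i : Fin (n + 1)) :
    confWeightPruned nobs w wstar (obsAt D₁ g (Fin.last n)) g i
      = exchangeMass nobs w wstar D₁ D₀ g i
        / ∑ j, exchangeMass nobs w wstar D₁ D₀ g j := by
  simp_rw [confWeightPruned, ← hg.rawWeight_mul, ← Finset.sum_mul]
  -- Only the common factor has to be nonzero; if the total mass vanishes, both quotients are zero
  -- by convention.
  rw [mul_div_mul_right _ _ (hg.firstDraws_mul_ne_zero _)]

/-- A configuration of positive probability is admissible, and its observed set is determined. -/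
lemma isAdmissible_of_jointMass_ne_zero {D A : Finset (Idx nr nc)}
    (h : jointMass nobs w wstar D A (fun i : Fin n => g i.castSucc) (g (Fin.last n)) ≠ 0) :
    IsAdmissible (trainSet D A fun i : Fin n => g i.castSucc) A g ∧
      D = obsAt (trainSet D A fun i : Fin n => g i.castSucc) g (Fin.last n) := by
  obtain ⟨⟨⟨-, hp⟩, hc⟩, hs⟩ := by simpa only [jointMass, mul_ne_zero_iff] using h
  obtain ⟨hA, hcard⟩ := pruneMass_ne_zero hp
  obtain ⟨hfam, hcal⟩ := calMass_ne_zero hc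
  obtain ⟨hgrp, hstar⟩ := psiCol_ne_zero hs
  have hD : D = obsAt (trainSet D A fun i : Fin n => g i.castSucc) g (Fin.last n) := by
    rw [obsAt, ← groupEntries_castSucc, trainSet]
    ext e
    have h1 := @hA e
    have h2 := @hcal e
    simp only [Finset.mem_union, Finset.mem_sdiff] at h2 ⊢
    tauto
  have hcalD : ∀ i : Fin n, entries (g i.castSucc) ⊆ D \ A := fun i e he =>
    hcal (Finset.mem_biUnion.2 ⟨i, Finset.mem_univ _, he⟩)
  have hstarD : ∀ e ∈ entries (g (Fin.last n)), e ∉ D := fun e he =>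
    Finset.mem_compl.1 (mem_prunedMiss.1 (hstar he)).1
  have htrain : (trainSet D A fun i : Fin n => g i.castSucc) ⊆ D := by
    intro e he
    rcases Finset.mem_union.1 he with he | he
    · exact hA he
    · exact (Finset.mem_sdiff.1 (Finset.mem_sdiff.1 he).1).1
  have hfull : IsGroupFamily g := by
    refine ⟨fun i => ?_, fun i j hij => ?_⟩
    · induction i using Fin.lastCases with
      | last => exact hgrp
      | cast i => exact hfam.group i
    · induction i using Fin.lastCases with
      | last =>
        induction j using Fin.lastCases with
        | last => exact absurd rfl hij
        | cast j =>
          exact Finset.disjoint_left.2 fun e he he' =>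
            hstarD e he (Finset.mem_sdiff.1 (hcalD j he')).1
      | cast i =>
        induction j using Fin.lastCases with
        | last =>
          exact Finset.disjoint_left.2 fun e he he' =>
            hstarD e he' (Finset.mem_sdiff.1 (hcalD i he)).1
        | cast j => exact hfam.disjoint i j fun h => hij (by rw [h])
  have hdisj : ∀ i, Disjoint (entries (g i)) (trainSet D A fun i : Fin n => g i.castSucc) := by
    intro i
    rw [Finset.disjoint_left]
    intro e he ht
    induction i using Fin.lastCases with
    | last => exact hstarD e he (htrain ht)
    | cast i =>
      rcases Finset.mem_union.1 ht with ht | ht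
      · exact (Finset.mem_sdiff.1 (hcalD i he)).2 ht
      · exact (Finset.mem_sdiff.1 ht).2 (Finset.mem_biUnion.2 ⟨i, Finset.mem_univ _, he⟩)
  refine ⟨⟨hfull, hdisj, Finset.subset_union_left, fun c => ?_⟩, hD⟩
  rw [hcard c]
  -- The observed set is the training set plus whole groups, which contribute multiples of `K` to
  -- every column.
  conv_lhs => rw [hD]
  rw [obsAt, col, Finset.filter_union, Finset.card_union_of_disjoint
    (Finset.disjoint_filter_filter ((Finset.disjoint_biUnion_right _ _ _).2
      fun i _ => (hdisj i).symm))]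
  change (_ + (col _ c).card) % K = _
  rw [card_col_biUnion_entries hfull, Nat.add_mul_mod_self_left]
  rfl

lemma IsAdmissible.trainSet_obsAt (hg : IsAdmissible D₁ D₀ g) :
    trainSet (obsAt D₁ g (Fin.last n)) D₀ (fun i : Fin n => g i.castSucc) = D₁ := by
  rw [trainSet, groupEntries_castSucc, obsAt]
  have hd := hg.disjoint_biUnion (Finset.univ.erase (Fin.last n))
  set G := (Finset.univ.erase (Fin.last n)).biUnion fun i => entries (g i)
  ext e
  have h1 := fun h : e ∈ D₁ => Finset.disjoint_left.1 hd h
  have h2 := @hg.subset e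
  simp only [Finset.mem_union, Finset.mem_sdiff]
  tauto

end ExchangeMass

/-! ### Weighted exchangeability and coverage -/

section Coverage

/-- Among points weighted by `q`, those whose strict lower tail has at least a share `1 - α` of
the total weight have themselves at most a share `α`. -/
lemma sum_filter_lowerTail_le {ι : Type*} [Fintype ι] {q s : ι → ℝ} (hq : ∀ i, 0 ≤ q i) {α : ℝ}
    (hα : 0 ≤ α) :
    ∑ j ∈ Finset.univ.filter (fun j => (1 - α) * ∑ i, q i
        ≤ ∑ i ∈ Finset.univ.filter (fun i => s i < s j), q i), q j ≤ α * ∑ i, q i := by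
  set B := Finset.univ.filter (fun j => (1 - α) * ∑ i, q i
        ≤ ∑ i ∈ Finset.univ.filter (fun i => s i < s j), q i) with hB
  rcases B.eq_empty_or_nonempty with h | h
  · rw [h, Finset.sum_empty]
    exact mul_nonneg hα (Finset.sum_nonneg fun i _ => hq i)
  -- All of `B` lies weakly above its lowest-scoring point `j`, hence in the complement of a lower
  -- tail of share at least `1 - α`.
  · obtain ⟨j, hj, hmin⟩ := B.exists_min_image s h
    have h1 := (Finset.mem_filter.1 hj).2
    have h2 := Finset.sum_filter_add_sum_filter_not Finset.univ (fun i => s i < s j) q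
    have h3 : ∑ i ∈ B, q i ≤ ∑ i ∈ Finset.univ.filter (fun i => ¬ s i < s j), q i :=
      Finset.sum_le_sum_of_subset_of_nonneg
        (fun i hi => by simpa using hmin i hi) fun i _ _ => hq i
    linarith

variable {β : Type*} [Fintype β] {n : ℕ}

/-- If `F g j` is the mass of the configuration in which `g j` is the test point, then with
probability at most `α` the score of the test point has a weighted lower tail of at least
`1 - α`. -/
lemma sum_filter_lowerTail_last_le {F : (Fin (n + 1) → β) → Fin (n + 1) → ℝ}
    (hF : ∀ g j, 0 ≤ F g j)
    (hperm : ∀ g (σ : Equiv.Perm (Fin (n + 1))) j, F (fun i => g (σ i)) j = F g (σ j))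
    (s : β → ℝ) {α : ℝ} (hα : 0 ≤ α) :
    ∑ g ∈ Finset.univ.filter (fun g : Fin (n + 1) → β => (1 - α) * ∑ i, F g i
        ≤ ∑ i ∈ Finset.univ.filter (fun i => s (g i) < s (g (Fin.last n))), F g i),
      F g (Fin.last n) ≤ α * ∑ g, F g (Fin.last n) := by
  have hswap : ∀ H : (Fin (n + 1) → β) → ℝ, ∀ j,
      ∑ g : Fin (n + 1) → β, H (fun i => g (Equiv.swap j (Fin.last n) i)) = ∑ g, H g := by
    intro H j
    exact Equiv.sum_comp (Equiv.arrowCongr (Equiv.swap j (Fin.last n)).symm (Equiv.refl β)) H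
  -- Each transposition permutes the tuples, so summing over all `j` counts the total `n + 1` times.
  have havg : ∀ H : (Fin (n + 1) → β) → ℝ, ((n : ℝ) + 1) * ∑ g, H g
      = ∑ g : Fin (n + 1) → β, ∑ j : Fin (n + 1),
        H (fun i => g (Equiv.swap j (Fin.last n) i)) := by
    intro H
    rw [Finset.sum_comm]
    simp_rw [hswap H]
    simp
  have hpos : (0 : ℝ) < (n : ℝ) + 1 := by positivity
  refine le_of_mul_le_mul_left ?_ hpos
  -- After averaging, the inequality is proved for each tuple `g` separately, with every `g j` in
  -- turn as the test point.
  rw [Finset.sum_filter, havg, mul_left_comm, havg, Finset.mul_sum]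
  refine Finset.sum_le_sum fun g _ => ?_
  have hlast : ∀ j, F (fun i => g (Equiv.swap j (Fin.last n) i)) (Fin.last n) = F g j := by
    intro j
    rw [hperm, Equiv.swap_apply_right]
  have htotal : ∀ j, ∑ i, F (fun i => g (Equiv.swap j (Fin.last n) i)) i = ∑ i, F g i := by
    intro j
    simp_rw [hperm]
    exact Equiv.sum_comp _ _
  have htail : ∀ j, ∑ i ∈ Finset.univ.filter (fun i =>
        s (g (Equiv.swap j (Fin.last n) i)) < s (g (Equiv.swap j (Fin.last n) (Fin.last n)))),
        F (fun i => g (Equiv.swap j (Fin.last n) i)) i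
      = ∑ i ∈ Finset.univ.filter (fun i => s (g i) < s (g j)), F g i := by
    intro j
    simp_rw [hperm, Finset.sum_filter, Equiv.swap_apply_right]
    exact Equiv.sum_comp (Equiv.swap j (Fin.last n))
      fun i => if s (g i) < s (g j) then F g i else 0
  simp_rw [hlast, htotal, htail]
  rw [← Finset.sum_filter]
  exact sum_filter_lowerTail_le (hF g) hα

/-- A finite weighted quantile of positive level is attained at one of the points. -/
lemma wQuantile_eq_top_or {n : ℕ} {b : ℝ} (hb : 0 < b) (p S : Fin n → ℝ) :
    wQuantile b p S = ⊤ ∨ ∃ i, wQuantile b p S = (S i : EReal) ∧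
      b ≤ ∑ j ∈ Finset.univ.filter (fun j => S j ≤ S i), p j := by
  set T : Finset (Fin n) := Finset.univ.filter
    (fun i => b ≤ ∑ j ∈ Finset.univ.filter (fun j => S j ≤ S i), p j) with hT
  -- The cumulative weight at `s` is that at the largest score not exceeding `s`; such a score
  -- exists because `b > 0` excludes the empty sum.
  have hlow : ∀ s : ℝ, b ≤ ∑ j ∈ Finset.univ.filter (fun j => S j ≤ s), p j →
      ∃ i ∈ T, S i ≤ s := by
    intro s hs
    have hne : (Finset.univ.filter (fun j => S j ≤ s)).Nonempty := by
      by_contra h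
      rw [Finset.not_nonempty_iff_eq_empty] at h
      rw [h, Finset.sum_empty] at hs
      exact hb.not_ge hs
    obtain ⟨i, hi, hmax⟩ := Finset.exists_max_image _ S hne
    have hi' : S i ≤ s := (Finset.mem_filter.1 hi).2
    refine ⟨i, ?_, hi'⟩
    rw [hT, Finset.mem_filter]
    refine ⟨Finset.mem_univ _, hs.trans_eq ?_⟩
    refine Finset.sum_congr ?_ fun _ _ => rfl
    ext j
    simp only [Finset.mem_filter, Finset.mem_univ, true_and]
    exact ⟨fun h => hmax j (by simpa using h), fun h => h.trans hi'⟩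
  rcases T.eq_empty_or_nonempty with h | h
  · left
    rw [wQuantile]
    refine (congrArg sInf ?_).trans sInf_empty
    rw [Set.image_eq_empty, Set.eq_empty_iff_forall_notMem]
    intro s hs
    obtain ⟨i, hi, -⟩ := hlow s hs
    rw [h] at hi
    simp at hi
  · right
    obtain ⟨i, hi, hmin⟩ := T.exists_min_image S h
    have hi' := (Finset.mem_filter.1 hi).2
    refine ⟨i, le_antisymm (sInf_le ⟨S i, hi', rfl⟩) (le_sInf ?_), hi'⟩
    rintro _ ⟨s, hs, rfl⟩
    obtain ⟨j, hj, hjs⟩ := hlow s hs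
    exact EReal.coe_le_coe_iff.2 ((hmin j hj).trans hjs)

end Coverage

/-! ### Scores, ties and non-coverage. -/

section Region

variable {K : ℕ} {C : Rule nr nc K} {M Mhat : Matrix (Fin nr) (Fin nc) ℝ}

lemma IsRuleAt.exists_mem_coveringParams (hC : IsRuleAt C Mhat) (x : Fin K → Idx nr nc) :
    ∃ τ, τ ∈ coveringParams C M Mhat x := by
  have h1 := hC.one x (valuesAt M x)
  have h2 : ∀ᶠ τ : ℝ in nhdsWithin 1 (Set.Iio 1), τ ∈ Set.Ioo (0 : ℝ) 1 :=
    Ioo_mem_nhdsLT one_pos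
  obtain ⟨τ, h3, h4⟩ := (h1.and h2).exists
  exact ⟨τ, ⟨h4.1.le, h4.2.le⟩, h3⟩

lemma bddBelow_coveringParams (x : Fin K → Idx nr nc) : BddBelow (coveringParams C M Mhat x) :=
  ⟨0, fun _ h => h.1.1⟩

lemma IsRuleAt.score_mem_Icc (hC : IsRuleAt C Mhat) (x : Fin K → Idx nr nc) :
    score C M Mhat x ∈ Set.Icc (0 : ℝ) 1 := by
  obtain ⟨τ, hτ⟩ := hC.exists_mem_coveringParams (M := M) x
  exact ⟨le_csInf ⟨τ, hτ⟩ fun _ h => h.1.1,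
    (csInf_le (bddBelow_coveringParams x) hτ).trans hτ.1.2⟩

lemma IsRuleAt.valuesAt_mem_of_score_lt (hC : IsRuleAt C Mhat) {x : Fin K → Idx nr nc} {τ : ℝ}
    (h : score C M Mhat x < τ) (hτ : τ ≤ 1) : valuesAt M x ∈ C x τ Mhat := by
  obtain ⟨t, ht, htτ⟩ := exists_lt_of_csInf_lt (hC.exists_mem_coveringParams x) h
  exact hC.mono x t ht.1 τ ⟨(hC.score_mem_Icc x).1.trans h.le, hτ⟩ htτ ht.2

/-- If the region misses the test group, then the groups with smaller scores have weight at least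
`1 - α`. -/
lemma IsRuleAt.le_sum_of_notMem_region (hC : IsRuleAt C Mhat) {n : ℕ} {α : ℝ} (hα : α < 1)
    {p : Fin (n + 1) → ℝ} (hp : ∀ i, 0 ≤ p i) {g : Fin (n + 1) → Fin K → Idx nr nc}
    (hscore : (∀ x, score C M Mhat x ∈ coveringParams C M Mhat x) ∨
      Function.Injective (fun i => score C M Mhat (g i)))
    (h : valuesAt M (g (Fin.last n)) ∉
      region C M Mhat α p (fun i : Fin n => g i.castSucc) (g (Fin.last n))) :
    1 - α ≤ ∑ i ∈ Finset.univ.filter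
      (fun i => score C M Mhat (g i) < score C M Mhat (g (Fin.last n))), p i := by
  have hb : 0 < 1 - α := by linarith
  rcases wQuantile_eq_top_or hb (fun i : Fin n => p i.castSucc)
    (fun i => score C M Mhat (g i.castSucc)) with htop | ⟨i, hi, hle⟩
  · simp [region, htop] at h
  · have h' : valuesAt M (g (Fin.last n)) ∉
        C (g (Fin.last n)) (score C M Mhat (g i.castSucc)) Mhat := by
      simpa [region, hi] using h
    have hlt : score C M Mhat (g i.castSucc) < score C M Mhat (g (Fin.last n)) := by
      rcases lt_trichotomy (score C M Mhat (g i.castSucc)) (score C M Mhat (g (Fin.last n)))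
        with hl | he | hg
      · exact hl
      -- A tie at the cutoff is harmless if the infimum is attained, since the region at that
      -- parameter then covers; distinct scores rule it out.
      · rcases hscore with hatt | hinj
        · exact absurd (he ▸ (hatt (g (Fin.last n))).2) h'
        · exact absurd (hinj he) (Fin.castSucc_ne_last i)
      · exact absurd (hC.valuesAt_mem_of_score_lt hg (hC.score_mem_Icc _).2) h'
    -- Calibration groups at or below the cutoff lie strictly below the test score.
    refine hle.trans ?_
    refine (Finset.sum_map _ Fin.castSuccEmb p).symm.trans_le ?_
    refine Finset.sum_le_sum_of_subset_of_nonneg ?_ fun j _ _ => hp j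
    intro j hj
    obtain ⟨k, hk, rfl⟩ := Finset.mem_map.1 hj
    simp only [Finset.mem_filter, Finset.mem_univ, true_and] at hk ⊢
    exact hk.trans_lt hlt

end Region

/-! ### Random variables with finitely many values -/

section FiniteRange

variable {Ω β : Type*} [MeasurableSpace Ω] {μ : Measure Ω} [Fintype β] {Z : Ω → β}

lemma measurableSet_of_measurableSet_fiber (hZ : ∀ z, MeasurableSet {ω | Z ω = z})
    (P : β → Prop) : MeasurableSet {ω | P (Z ω)} := by
  have h : {ω | P (Z ω)} = ⋃ z ∈ {z | P z}, {ω | Z ω = z} := by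
    ext ω
    simp
  rw [h]
  exact (Set.toFinite _).measurableSet_biUnion fun z _ => hZ z

lemma measureReal_eq_sum_fiber [IsFiniteMeasure μ] (hZ : ∀ z, MeasurableSet {ω | Z ω = z})
    (P : β → Prop) [DecidablePred P] :
    μ.real {ω | P (Z ω)} = ∑ z ∈ Finset.univ.filter P, μ.real {ω | Z ω = z} := by
  have h : {ω | P (Z ω)} = ⋃ z ∈ Finset.univ.filter P, {ω | Z ω = z} := by
    ext ω
    simp
  rw [h, measureReal_biUnion_finset _ fun z _ => hZ z]
  intro z _ z' _ hzz'
  exact Set.disjoint_left.2 fun ω h1 h2 => hzz' (h1.symm.trans h2)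

/-- There are finitely many null fibers, so their union is null. This turns statements about
configurations of positive probability into almost sure ones. -/
lemma ae_measure_fiber_ne_zero (μ : Measure Ω) (Z : Ω → β) :
    ∀ᵐ ω ∂μ, μ {ω' | Z ω' = Z ω} ≠ 0 := by
  rw [ae_iff]
  refine measure_mono_null (t := ⋃ z ∈ {z | μ {ω | Z ω = z} = 0}, {ω | Z ω = z}) ?_ ?_
  · intro ω h
    simpa using h
  · exact (measure_biUnion_null_iff (Set.to_countable _)).2 fun z hz => hz

end FiniteRange

/-! ### The law of the sample -/

section Law

variable {Ω : Type*} [MeasurableSpace Ω] {μ : Measure Ω} {nobs n K : ℕ}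
  {w wstar : Idx nr nc → ℝ} {Xobs : Ω → Fin nobs → Idx nr nc} {Dprune : Ω → Finset (Idx nr nc)}
  {Xcal : Ω → Fin n → Fin K → Idx nr nc} {Xstar : Ω → Fin K → Idx nr nc}

lemma IsSample.measurableSet_fiber (h : IsSample μ w wstar Xobs Dprune Xcal Xstar)
    (z : Finset (Idx nr nc) × Finset (Idx nr nc) × (Fin n → Fin K → Idx nr nc)
      × (Fin K → Idx nr nc)) :
    MeasurableSet {ω | (entries (Xobs ω), Dprune ω, Xcal ω, Xstar ω) = z} := by
  obtain ⟨D, A, x, y⟩ := z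
  have heq : {ω | (entries (Xobs ω), Dprune ω, Xcal ω, Xstar ω) = (D, A, x, y)}
      = {ω | entries (Xobs ω) = D} ∩ ({ω | Dprune ω = A} ∩ ({ω | Xcal ω = x} ∩
        {ω | Xstar ω = y})) := by
    ext ω
    simp
  rw [heq]
  exact (measurableSet_of_measurableSet_fiber h.measurable_obs fun x => entries x = D).inter
    ((h.measurable_prune A).inter ((h.measurable_cal x).inter (h.measurable_star y)))

variable [IsProbabilityMeasure μ]

/-- Kept apart from the test draw, whose weight may vanish after an exchange. -/
lemma IsSample.law_prune_cal (h : IsSample μ w wstar Xobs Dprune Xcal Xstar)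
    (D A : Finset (Idx nr nc)) (x : Fin n → Fin K → Idx nr nc) :
    μ.real {ω | entries (Xobs ω) = D ∧ Dprune ω = A ∧ Xcal ω = x}
      = psiSet nobs Finset.univ w D * pruneMass K D A * calMass (D \ A) x := by
  have hobs : μ.real {ω | entries (Xobs ω) = D} = psiSet nobs Finset.univ w D := by
    rw [measureReal_eq_sum_fiber h.measurable_obs fun x => entries x = D, psiSet]
    exact Finset.sum_congr rfl fun x _ => h.law_obs x
  rw [h.law_cal, h.law_prune, hobs]

variable [NeZero K]

omit [NeZero K] in
lemma IsSample.law (h : IsSample μ w wstar Xobs Dprune Xcal Xstar)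
    (D A : Finset (Idx nr nc)) (x : Fin n → Fin K → Idx nr nc) (y : Fin K → Idx nr nc) :
    μ.real {ω | entries (Xobs ω) = D ∧ Dprune ω = A ∧ Xcal ω = x ∧ Xstar ω = y}
      = jointMass nobs w wstar D A x y := by
  rw [h.law_star, h.law_prune_cal, jointMass]

/-- The groups: calibration groups followed by the test group. -/
def allGroups (x : Fin n → Fin K → Idx nr nc) (y : Fin K → Idx nr nc) :
    Fin (n + 1) → Fin K → Idx nr nc :=
  Fin.snoc x y

omit [NeZero K] in
lemma allGroups_castSucc (x : Fin n → Fin K → Idx nr nc) (y : Fin K → Idx nr nc) :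
    (fun i : Fin n => allGroups x y i.castSucc) = x := by
  funext i
  simp [allGroups]

omit [NeZero K] in
lemma allGroups_last (x : Fin n → Fin K → Idx nr nc) (y : Fin K → Idx nr nc) :
    allGroups x y (Fin.last n) = y := by
  simp [allGroups]

omit [NeZero K] in
lemma allGroups_eq_iff {x : Fin n → Fin K → Idx nr nc} {y : Fin K → Idx nr nc}
    {g : Fin (n + 1) → Fin K → Idx nr nc} :
    allGroups x y = g ↔ x = (fun i : Fin n => g i.castSucc) ∧ y = g (Fin.last n) := by
  constructor
  · rintro rfl
    rw [allGroups_castSucc, allGroups_last]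
    exact ⟨rfl, rfl⟩
  · rintro ⟨rfl, rfl⟩
    exact Fin.snoc_init_self g

/-- Almost surely the configuration is admissible and the observed set is determined by the
training set and the groups. -/
lemma IsSample.ae_isAdmissible (h : IsSample μ w wstar Xobs Dprune Xcal Xstar) :
    ∀ᵐ ω ∂μ, IsAdmissible (trainSet (entries (Xobs ω)) (Dprune ω) (Xcal ω)) (Dprune ω)
        (allGroups (Xcal ω) (Xstar ω)) ∧
      entries (Xobs ω) = obsAt (trainSet (entries (Xobs ω)) (Dprune ω) (Xcal ω))
        (allGroups (Xcal ω) (Xstar ω)) (Fin.last n) := by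
  filter_upwards [ae_measure_fiber_ne_zero μ
    fun ω => (entries (Xobs ω), Dprune ω, Xcal ω, Xstar ω)] with ω hω
  simp only [Prod.mk.injEq] at hω
  have hne : jointMass nobs w wstar (entries (Xobs ω)) (Dprune ω) (Xcal ω) (Xstar ω) ≠ 0 := by
    rw [← h.law]
    exact (measureReal_ne_zero_iff).2 hω
  have := isAdmissible_of_jointMass_ne_zero (g := allGroups (Xcal ω) (Xstar ω)) nobs w wstar
    (D := entries (Xobs ω)) (A := Dprune ω)
  rw [allGroups_castSucc, allGroups_last] at this
  exact this hne

/-- The probability of the groups `g`, together with given training and pruned sets. -/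
lemma IsSample.measureReal_eq_exchangeMass (h : IsSample μ w wstar Xobs Dprune Xcal Xstar)
    (D₁ D₀ : Finset (Idx nr nc)) (g : Fin (n + 1) → Fin K → Idx nr nc) :
    μ.real {ω | (trainSet (entries (Xobs ω)) (Dprune ω) (Xcal ω) = D₁ ∧ Dprune ω = D₀) ∧
        allGroups (Xcal ω) (Xstar ω) = g}
      = exchangeMass nobs w wstar D₁ D₀ g (Fin.last n) := by
  by_cases hg : IsAdmissible D₁ D₀ g
  · rw [hg.exchangeMass_last, ← h.law]
    refine measureReal_congr ?_
    filter_upwards [h.ae_isAdmissible] with ω hω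
    refine propext ?_
    change ((_ ∧ _) ∧ _) ↔ (_ ∧ _ ∧ _ ∧ _)
    rw [allGroups_eq_iff]
    constructor
    · rintro ⟨⟨h1, h2⟩, h3, h4⟩
      refine ⟨?_, h2, h3, h4⟩
      rw [h1, allGroups_eq_iff.2 ⟨h3, h4⟩] at hω
      exact hω.2
    · rintro ⟨h1, h2, h3, h4⟩
      refine ⟨⟨?_, h2⟩, h3, h4⟩
      rw [h1, h2, h3, hg.trainSet_obsAt]
  · rw [exchangeMass, if_neg hg, measureReal_eq_zero_iff]
    have hnull := ae_iff.1 h.ae_isAdmissible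
    refine measure_mono_null ?_ hnull
    intro ω hω hadm
    refine hg ?_
    obtain ⟨⟨h1, h2⟩, h3⟩ := hω
    rw [h1, h2, h3] at hadm
    exact hadm.1

/-- Moving `j` to the last position makes the mass an actual probability, so no signs of factors
need checking. -/
lemma IsSample.exchangeMass_nonneg (h : IsSample μ w wstar Xobs Dprune Xcal Xstar)
    (D₁ D₀ : Finset (Idx nr nc)) (g : Fin (n + 1) → Fin K → Idx nr nc) (j : Fin (n + 1)) :
    0 ≤ exchangeMass nobs w wstar D₁ D₀ g j := by
  have h1 := exchangeMass_comp_perm nobs w wstar D₁ D₀ g (Equiv.swap j (Fin.last n)) (Fin.last n)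
  rw [Equiv.swap_apply_right] at h1
  rw [← h1, ← h.measureReal_eq_exchangeMass]
  exact measureReal_nonneg

/-- If the pruned and unpruned denominators agree for all observed sets of positive probability,
the two kinds of conformalization weights agree. -/
lemma IsAdmissible.confWeight_eq_pruned {D₁ D₀ : Finset (Idx nr nc)}
    {g : Fin (n + 1) → Fin K → Idx nr nc} (hg : IsAdmissible D₁ D₀ g)
    (hK : ∀ i, psiSet nobs Finset.univ w (obsAt D₁ g i) ≠ 0 →
      ∀ c, K ≤ (col (obsAt D₁ g i)ᶜ c).card) :
    confWeight nobs w wstar (obsAt D₁ g (Fin.last n)) g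
      = confWeightPruned nobs w wstar (obsAt D₁ g (Fin.last n)) g := by
  have hraw : ∀ i, rawWeight nobs w wstar (obsAt D₁ g (Fin.last n)) g
      (firstDenom wstar (obsAt D₁ g (Fin.last n)) g) i
      = rawWeight nobs w wstar (obsAt D₁ g (Fin.last n)) g
        (firstDenomPruned wstar (obsAt D₁ g (Fin.last n)) g) i := by
    intro i
    rw [rawWeight, rawWeight, hg.swapObs_obsAt]
    -- An exchanged observed set of probability zero gives raw weight zero whatever the denominator.
    by_cases h0 : psiSet nobs Finset.univ w (obsAt D₁ g i) = 0
    · simp only [h0, zero_mul]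
    · rw [hg.firstDenom_eq_pruned wstar (hK i h0)]
  funext i
  simp only [confWeight, confWeightPruned, hraw]

/-- If all columns almost surely have enough missing entries, then so do they after an exchange. -/
lemma IsSample.le_card_col_obsAt (h : IsSample μ w wstar Xobs Dprune Xcal Xstar)
    {D₁ D₀ : Finset (Idx nr nc)}
    (hK : ∀ᵐ ω ∂μ, trainSet (entries (Xobs ω)) (Dprune ω) (Xcal ω) = D₁ ∧ Dprune ω = D₀ →
      ∀ c, K ≤ (col (entries (Xobs ω))ᶜ c).card)
    {g : Fin (n + 1) → Fin K → Idx nr nc} (hg : IsAdmissible D₁ D₀ g) (i : Fin (n + 1))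
    (hi : psiSet nobs Finset.univ w (obsAt D₁ g i) ≠ 0) (c : Fin nc) :
    K ≤ (col (obsAt D₁ g i)ᶜ c).card := by
  -- Relabelling makes `g i` the test group, so that the exchanged observed set is one that the
  -- sample can produce.
  have hg' := (isAdmissible_comp_perm_iff (Equiv.swap i (Fin.last n))).2 hg
  have hobs := obsAt_comp_perm D₁ g (Equiv.swap i (Fin.last n)) (Fin.last n)
  rw [Equiv.swap_apply_right] at hobs
  rw [← hobs] at hi ⊢
  generalize (fun k => g (Equiv.swap i (Fin.last n) k)) = g' at hg' hi ⊢
  have hpos := h.law_prune_cal (obsAt D₁ g' (Fin.last n)) D₀ fun k : Fin n => g' k.castSucc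
  rw [mul_assoc, hg'.pruneMass_mul_calMass] at hpos
  have hne := mul_ne_zero hi
    (hg'.firstDraws_mul_ne_zero fun c => countAt g' (Fin.last n) c)
  rw [← hpos, measureReal_ne_zero_iff] at hne
  -- An event of positive probability meets the almost sure event of `hK`, and the bound depends
  -- only on the observed set.
  obtain ⟨ω, ⟨h1, h2, h3⟩, h4⟩ : ∃ ω, (entries (Xobs ω) = obsAt D₁ g' (Fin.last n) ∧
      Dprune ω = D₀ ∧ Xcal ω = fun k : Fin n => g' k.castSucc) ∧
      (trainSet (entries (Xobs ω)) (Dprune ω) (Xcal ω) = D₁ ∧ Dprune ω = D₀ →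
        ∀ c, K ≤ (col (entries (Xobs ω))ᶜ c).card) := by
    by_contra hcon
    push Not at hcon
    have hnull := ae_iff.1 hK
    refine hne (measure_mono_null ?_ hnull)
    intro ω hω hωK
    obtain ⟨h1, c, hc⟩ := hcon ω hω
    exact absurd (hωK h1 c) (not_le.2 hc)
  rw [← h1]
  exact h4 ⟨by rw [h1, h2, h3, hg'.trainSet_obsAt], h2⟩ c

/-- Coverage of the region built from weights that, almost surely, are proportional to the
probabilities of the exchanged configurations. -/
lemma IsSample.le_measureReal_inter (h : IsSample μ w wstar Xobs Dprune Xcal Xstar)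
    {D₁ D₀ : Finset (Idx nr nc)} {M Mhat : Matrix (Fin nr) (Fin nc) ℝ} {C : Rule nr nc K}
    (hC : IsRuleAt C Mhat) {s : Set Ω}
    (hs : s = {ω | trainSet (entries (Xobs ω)) (Dprune ω) (Xcal ω) = D₁ ∧ Dprune ω = D₀})
    (hscore : ∀ᵐ ω ∂μ, ω ∈ s → (∀ x, score C M Mhat x ∈ coveringParams C M Mhat x) ∨
      Function.Injective (fun i => score C M Mhat (allGroups (Xcal ω) (Xstar ω) i)))
    {α : ℝ} (hα : α ∈ Set.Ioo (0 : ℝ) 1) {p : Ω → Fin (n + 1) → ℝ}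
    (hp : ∀ᵐ ω ∂μ, ω ∈ s → p ω = confWeightPruned nobs w wstar (entries (Xobs ω))
      (allGroups (Xcal ω) (Xstar ω))) :
    (1 - α) * μ.real s ≤ μ.real (s ∩ {ω | valuesAt M (Xstar ω) ∈
      region C M Mhat α (p ω) (Xcal ω) (Xstar ω)}) := by
  classical
  set F : (Fin (n + 1) → Fin K → Idx nr nc) → Fin (n + 1) → ℝ :=
    exchangeMass nobs w wstar D₁ D₀ with hF
  set X : Ω → Fin (n + 1) → Fin K → Idx nr nc := fun ω => allGroups (Xcal ω) (Xstar ω) with hX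
  set bad : (Fin (n + 1) → Fin K → Idx nr nc) → Prop := fun g => (1 - α) * ∑ i, F g i
    ≤ ∑ i ∈ Finset.univ.filter
      (fun i => score C M Mhat (g i) < score C M Mhat (g (Fin.last n))), F g i with hbad
  have hFnn : ∀ g j, 0 ≤ F g j := h.exchangeMass_nonneg D₁ D₀
  have hmass : ∀ g, μ.real (s ∩ {ω | X ω = g}) = F g (Fin.last n) := fun g => by
    rw [hs, hF, ← h.measureReal_eq_exchangeMass]
    rfl
  have hmeas : ∀ g, MeasurableSet (s ∩ {ω | X ω = g}) := fun g => by
    rw [hs]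
    exact measurableSet_of_measurableSet_fiber h.measurableSet_fiber
      fun z => (trainSet z.1 z.2.1 z.2.2.1 = D₁ ∧ z.2.1 = D₀) ∧ allGroups z.2.2.1 z.2.2.2 = g
  have htotal : μ.real s = ∑ g, F g (Fin.last n) := by
    have hunion : s = ⋃ g ∈ Finset.univ, s ∩ {ω | X ω = g} := by
      ext ω
      simp
    rw [hunion, measureReal_biUnion_finset _ fun g _ => hmeas g]
    · exact Finset.sum_congr rfl fun g _ => hmass g
    · intro g _ g' _ hgg'
      exact Set.disjoint_left.2 fun ω h1 h2 => hgg' (h1.2.symm.trans h2.2)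
  have hbadle : μ.real (s ∩ {ω | bad (X ω)}) ≤ α * μ.real s := by
    have hunion : s ∩ {ω | bad (X ω)} = ⋃ g ∈ Finset.univ.filter bad, s ∩ {ω | X ω = g} := by
      ext ω
      simp [and_comm]
    rw [hunion, htotal]
    refine (measureReal_biUnion_finset_le _ _).trans ?_
    rw [Finset.sum_congr rfl fun g _ => hmass g]
    exact sum_filter_lowerTail_last_le hFnn
      (exchangeMass_comp_perm nobs w wstar D₁ D₀) (score C M Mhat) hα.1.le
  set cov : Set Ω := {ω | valuesAt M (Xstar ω) ∈ region C M Mhat α (p ω) (Xcal ω) (Xstar ω)}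
    with hcov
  -- Almost surely on `s`, a miss forces `bad`. Only monotonicity and subadditivity are used
  -- afterwards, so `cov` need not be measurable.
  have hae : s ≤ᵐ[μ] (s ∩ cov ∪ s ∩ {ω | bad (X ω)} : Set Ω) := by
    filter_upwards [h.ae_isAdmissible, hscore, hp] with ω hadm hsc hpω hω
    have hω' : trainSet (entries (Xobs ω)) (Dprune ω) (Xcal ω) = D₁ ∧ Dprune ω = D₀ := by
      rw [hs] at hω
      exact hω
    rw [hω'.1, hω'.2] at hadm
    by_cases hc : ω ∈ cov
    · exact Or.inl ⟨hω, hc⟩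
    refine Or.inr ⟨hω, ?_⟩
    have hpF : ∀ i, p ω i = F (X ω) i / ∑ j, F (X ω) j := fun i => by
      rw [hpω hω, hadm.2]
      exact hadm.1.confWeightPruned_eq nobs w wstar i
    have hsum : 0 ≤ ∑ j, F (X ω) j := Finset.sum_nonneg fun j _ => hFnn _ j
    have htail := hC.le_sum_of_notMem_region (M := M) (p := p ω) (g := X ω) hα.2
      (fun i => by rw [hpF]; exact div_nonneg (hFnn _ i) hsum) (hsc hω) (by
        change valuesAt M (allGroups (Xcal ω) (Xstar ω) (Fin.last n)) ∉ region C M Mhat α (p ω)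
          (fun i : Fin n => allGroups (Xcal ω) (Xstar ω) i.castSucc)
          (allGroups (Xcal ω) (Xstar ω) (Fin.last n))
        rw [allGroups_castSucc, allGroups_last]
        exact hc)
    change (1 - α) * ∑ i, F (X ω) i ≤ ∑ i ∈ Finset.univ.filter (fun i =>
      score C M Mhat (X ω i) < score C M Mhat (X ω (Fin.last n))), F (X ω) i
    rcases hsum.eq_or_lt with h0 | h0
    -- With zero total mass the weights carry no information, but `bad` holds trivially.
    · rw [← h0, mul_zero]
      exact Finset.sum_nonneg fun j _ => hFnn _ j
    · simp_rw [hpF] at htail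
      rwa [← Finset.sum_div, le_div_iff₀ h0] at htail
  have hle : μ.real s ≤ μ.real (s ∩ cov) + μ.real (s ∩ {ω | bad (X ω)}) :=
    (ENNReal.toReal_mono (measure_ne_top _ _) (measure_mono_ae hae)).trans
      (measureReal_union_le _ _)
  linarith

end Law

end SCMC

end

/-! ### Conditional coverage. -/

theorem theorem1 {nr nc nobs n K : ℕ} [NeZero K]
    {Ω : Type*} [MeasurableSpace Ω] (μ : MeasureTheory.Measure Ω)
    [MeasureTheory.IsProbabilityMeasure μ]
    -- the fixed matrix and the sampling and test weights
    (M : Matrix (Fin nr) (Fin nc) ℝ) (w wstar : SCMC.Idx nr nc → ℝ)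
    (hw : ∀ e, 0 ≤ w e) (hwstar : ∀ e, 0 ≤ wstar e)
    -- the observed indices, the output of the calibration algorithm, and the test group
    (Xobs : Ω → Fin nobs → SCMC.Idx nr nc) (Dprune : Ω → Finset (SCMC.Idx nr nc))
    (Xcal : Ω → Fin n → Fin K → SCMC.Idx nr nc) (Xstar : Ω → Fin K → SCMC.Idx nr nc)
    (hsample : SCMC.IsSample μ w wstar Xobs Dprune Xcal Xstar)
    (Dobs Dtrain : Ω → Finset (SCMC.Idx nr nc))
    (hDobs : ∀ ω, Dobs ω = SCMC.entries (Xobs ω))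
    (hDtrain : ∀ ω, Dtrain ω = SCMC.trainSet (Dobs ω) (Dprune ω) (Xcal ω))
    -- any completion algorithm, which sees only the training entries
    (alg : (D : Finset (SCMC.Idx nr nc)) → (D → ℝ) → Matrix (Fin nr) (Fin nc) ℝ)
    (Mhat : Ω → Matrix (Fin nr) (Fin nc) ℝ)
    (hMhat : ∀ ω, Mhat ω = alg (Dtrain ω) (fun e => M e.1.1 e.1.2))
    -- any prediction rule
    (C : SCMC.Rule nr nc K) (hC : ∀ᵐ ω ∂μ, SCMC.IsRuleAt C (Mhat ω))
    -- the groups: calibration groups followed by the test group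
    (X : Ω → Fin (n + 1) → Fin K → SCMC.Idx nr nc)
    (hX : ∀ ω, X ω = Fin.snoc (Xcal ω) (Xstar ω))
    -- every score is an attained infimum, or else the scores have no ties
    (hscore : (∀ᵐ ω ∂μ, ∀ x, SCMC.score C M (Mhat ω) x ∈ SCMC.coveringParams C M (Mhat ω) x) ∨
      (∀ᵐ ω ∂μ, Function.Injective (fun i => SCMC.score C M (Mhat ω) (X ω i))))
    (α : ℝ) (hα : α ∈ Set.Ioo (0 : ℝ) 1)
    -- any realization of the training set and of the pruned set
    (D₁ D₀ : Finset (SCMC.Idx nr nc)) (hD : μ {ω | Dtrain ω = D₁ ∧ Dprune ω = D₀} ≠ 0) :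
    ((∀ᵐ ω ∂(ProbabilityTheory.cond μ {ω | Dtrain ω = D₁ ∧ Dprune ω = D₀}),
        ∀ c, K ≤ (SCMC.col (Dobs ω)ᶜ c).card) →
      1 - α ≤ (ProbabilityTheory.cond μ {ω | Dtrain ω = D₁ ∧ Dprune ω = D₀}).real
        {ω | SCMC.valuesAt M (Xstar ω) ∈ SCMC.region C M (Mhat ω) α
          (SCMC.confWeight nobs w wstar (Dobs ω) (X ω)) (Xcal ω) (Xstar ω)}) ∧
    1 - α ≤ (ProbabilityTheory.cond μ {ω | Dtrain ω = D₁ ∧ Dprune ω = D₀}).real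
      {ω | SCMC.valuesAt M (Xstar ω) ∈ SCMC.region C M (Mhat ω) α
        (SCMC.confWeightPruned nobs w wstar (Dobs ω) (X ω)) (Xcal ω) (Xstar ω)} := by
  classical
  set s : Set Ω := {ω | Dtrain ω = D₁ ∧ Dprune ω = D₀} with hs
  have hs' : s = {ω | SCMC.trainSet (SCMC.entries (Xobs ω)) (Dprune ω) (Xcal ω) = D₁ ∧
      Dprune ω = D₀} := by
    simp only [hs, hDtrain, hDobs]
  have hX' : ∀ ω, X ω = SCMC.allGroups (Xcal ω) (Xstar ω) := hX
  have hsmeas : MeasurableSet s := by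
    rw [hs']
    exact SCMC.measurableSet_of_measurableSet_fiber hsample.measurableSet_fiber
      fun z => SCMC.trainSet z.1 z.2.1 z.2.2.1 = D₁ ∧ z.2.1 = D₀
  -- The algorithm sees only the training entries, so the estimate is constant on `s`.
  set Mhat₁ : Matrix (Fin nr) (Fin nc) ℝ := alg D₁ (fun e => M e.1.1 e.1.2) with hMhat₁
  have hMhat' : ∀ ω ∈ s, Mhat ω = Mhat₁ := by
    intro ω hω
    have key : ∀ D, D = D₁ → alg D (fun e => M e.1.1 e.1.2) = Mhat₁ := by
      rintro D rfl
      rfl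
    rw [hMhat]
    exact key _ hω.1
  -- An almost sure property of a constant estimate on an event of positive probability holds
  -- outright.
  have hC₁ : SCMC.IsRuleAt C Mhat₁ := by
    by_contra hcon
    have hnull := MeasureTheory.ae_iff.1 hC
    refine hD (MeasureTheory.measure_mono_null ?_ hnull)
    intro ω hω hrule
    rw [hMhat' ω hω] at hrule
    exact hcon hrule
  have hscore₁ : ∀ᵐ ω ∂μ, ω ∈ s →
      (∀ x, SCMC.score C M Mhat₁ x ∈ SCMC.coveringParams C M Mhat₁ x) ∨
      Function.Injective
        (fun i => SCMC.score C M Mhat₁ (SCMC.allGroups (Xcal ω) (Xstar ω) i)) := by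
    rcases hscore with h | h
    · filter_upwards [h] with ω hω hωs
      rw [hMhat' ω hωs] at hω
      exact Or.inl hω
    · filter_upwards [h] with ω hω hωs
      rw [hMhat' ω hωs, hX'] at hω
      exact Or.inr hω
  have hcover : ∀ p : Ω → Fin (n + 1) → ℝ,
      (∀ᵐ ω ∂μ, ω ∈ s → p ω = SCMC.confWeightPruned nobs w wstar (Dobs ω) (X ω)) →
      1 - α ≤ (ProbabilityTheory.cond μ s).real {ω | SCMC.valuesAt M (Xstar ω) ∈
        SCMC.region C M (Mhat ω) α (p ω) (Xcal ω) (Xstar ω)} := by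
    intro p hp
    have hle := hsample.le_measureReal_inter (M := M) hC₁ hs' hscore₁ hα (p := p) (by
      simpa only [hDobs, hX'] using hp)
    have hset : s ∩ {ω | SCMC.valuesAt M (Xstar ω) ∈
          SCMC.region C M (Mhat ω) α (p ω) (Xcal ω) (Xstar ω)}
        = s ∩ {ω | SCMC.valuesAt M (Xstar ω) ∈
          SCMC.region C M Mhat₁ α (p ω) (Xcal ω) (Xstar ω)} := by
      ext ω
      simp only [Set.mem_inter_iff, Set.mem_ofPred_eq]
      exact and_congr_right fun hω => by rw [hMhat' ω hω]
    have hpos : 0 < μ.real s := ENNReal.toReal_pos hD (MeasureTheory.measure_ne_top _ _)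
    rw [MeasureTheory.measureReal_def, ProbabilityTheory.cond_apply hsmeas, ENNReal.toReal_mul,
      ENNReal.toReal_inv, hset]
    change _ ≤ (μ.real s)⁻¹ * μ.real _
    rw [inv_mul_eq_div, le_div_iff₀ hpos]
    exact hle
  -- For the first claim it remains to see that the two kinds of weights agree almost surely on `s`.
  refine ⟨fun hK => hcover _ ?_, hcover _ (Filter.Eventually.of_forall fun _ _ => rfl)⟩
  have hK' : ∀ᵐ ω ∂μ, ω ∈ s → ∀ c, K ≤ (SCMC.col (SCMC.entries (Xobs ω))ᶜ c).card := by
    rw [← MeasureTheory.ae_restrict_iff' hsmeas]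
    simp only [hDobs, ProbabilityTheory.cond] at hK
    exact (MeasureTheory.Measure.ae_ennreal_smul_measure_iff
      (ENNReal.inv_ne_zero.2 (MeasureTheory.measure_ne_top _ _))).1 hK
  filter_upwards [hsample.ae_isAdmissible] with ω hadm hω
  have hω' := hω
  rw [hs'] at hω'
  rw [hω'.1, hω'.2] at hadm
  rw [hDobs, hX', hadm.2]
  refine hadm.1.confWeight_eq_pruned fun i hi c =>
    hsample.le_card_col_obsAt ?_ hadm.1 i hi c
  filter_upwards [hK'] with ω' h1 h2
  exact h1 (by rw [hs']; exact h2)
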